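/- Let $d\in\{2,3\}$ and let $\Omega\subset\mathbb{R}^d$ be a bounded Lipschitz open set whose open complement $\mathbb{R}^d\setminus\overline{\Omega}$ is connected. For $k>0$ let $\Phi_k(x,y)=\frac{\mathrm i}{4}H^{(1)}_0(k|x-y|)$ if $d=2$ and $\Phi_k(x,y)=\frac{\mathrm e^{\mathrm i k|x-y|}}{4\pi|x-y|}$ if $d=3$, and let $S_k$ be the single-layer operator $$S_k\phi(x)=\int_{\partial\Omega}\Phi_k(x,y)\,\phi(y)\,\mathrm ds(y),\qquad \phi\in L^2(\partial\Omega),\ x\in\partial\Omega .$$ Let $H^1(\partial\Omega)$ be the completion of $\{u|_{\partial\Omega}:u\in C_c^\infty(\mathbb{R}^d)\}$ in the norm $\|u\|_{H^1(\partial\Omega)}=\big(\int_{\partial\Omega}(|\nabla_{\partial\Omega}u|^2+|u|^2)\,\mathrm ds\big)^{1/2}$, where $\nabla_{\partial\Omega}$ is the surface gradient. Suppose that $\partial\Omega$ contains a line segment $\{a+te:|t|<\delta\}$, for some $a\in\mathbb{R}^d$, some unit vector $e$ and some $\delta>0$, and that $\partial\Omega$ is $C^2$ in a neighbourhood of this segment.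 Then there exist $k_0>0$ and $C>0$, independent of $k$, such that, for all $k\ge k_0$, $$\|S_k\|_{L^2(\partial\Omega)\to L^2(\partial\Omega)}\ \ge\ C\,k^{-1/2}\qquad\text{and}\qquad \|S_k\|_{L^2(\partial\Omega)\to H^1(\partial\Omega)}\ \ge\ C\,k^{1/2}.$$ Here an operator norm is the supremum of the norm of $S_k\phi$ over $\|\phi\|_{L^2(\partial\Omega)}\le1$, with values in $[0,\infty]$ (a function outside the target space has norm $\infty$). -/

import Mathlib

open MeasureTheory Filter Topology Set
open scoped ENNReal NNReal ContDiff RealInnerProductSpace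

noncomputable section

namespace Helmholtz

/-- `ℝᵈ` with the Euclidean norm. -/
abbrev Space (d : ℕ) : Type := EuclideanSpace ℝ (Fin d)

/-! ### The fundamental solution -/

/-- The Bessel function of the first kind of order zero,
`J₀(t) = ∑ₘ (-1)ᵐ (t²/4)ᵐ / (m!)²`. -/
def besselJ0 (t : ℝ) : ℝ :=
  ∑' m : ℕ, (-1) ^ m * (t ^ 2 / 4) ^ m / (m.factorial : ℝ) ^ 2

/-- The Bessel function of the second kind of order zero, for `t > 0`:
`Y₀(t) = (2/π) (log (t/2) + γ) J₀(t) - (2/π) ∑ₘ (-1)ᵐ hₘ (t²/4)ᵐ / (m!)²`, where `γ` is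
Euler's constant and `hₘ = 1 + 1/2 + ⋯ + 1/m` (so the term `m = 0` vanishes). -/
def besselY0 (t : ℝ) : ℝ :=
  2 / Real.pi * (Real.log (t / 2) + Real.eulerMascheroniConstant) * besselJ0 t
    - 2 / Real.pi * ∑' m : ℕ,
        (-1) ^ m * (harmonic m : ℝ) * (t ^ 2 / 4) ^ m / (m.factorial : ℝ) ^ 2

/-- The Hankel function of the first kind of order zero, `H₀⁽¹⁾ = J₀ + i Y₀`, on `(0, ∞)`. -/
def hankelH0 (t : ℝ) : ℂ := (besselJ0 t : ℂ) + Complex.I * (besselY0 t : ℂ)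

/-- The outgoing fundamental solution `Φ_k(x, y)` of the Helmholtz equation `Δu + k²u = 0`:
`(i/4) H₀⁽¹⁾(k|x-y|)` for `d = 2` and `e^{ik|x-y|} / (4π|x-y|)` for `d = 3`.
It is used for these two dimensions only. -/
def fundamentalSolution (d : ℕ) (k : ℝ) (x y : Space d) : ℂ :=
  if d = 2 then Complex.I / 4 * hankelH0 (k * ‖x - y‖)
  else Complex.exp (Complex.I * k * ‖x - y‖) / (4 * Real.pi * ‖x - y‖)

/-! ### The domain -/

/-- Near `x`, the set `Ω` is the region below the graph of a Lipschitz function, after a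
rotation of the coordinates that makes the unit vector `ν` vertical; the function lives on the
hyperplane orthogonal to `ν`. -/
def IsLipschitzHypographAt {d : ℕ} (Ω : Set (Space d)) (x : Space d) : Prop :=
  ∃ (ν : Space d) (γ : (ℝ ∙ ν)ᗮ → ℝ) (L : ℝ≥0), ‖ν‖ = 1 ∧ LipschitzWith L γ ∧
    ∀ᶠ y in 𝓝 x, (y ∈ Ω ↔ ⟪ν, y⟫ < γ ((ℝ ∙ ν)ᗮ.orthogonalProjectionOnto y))

/-- `Ω` is a bounded Lipschitz open set whose open complement `ℝᵈ \ closure Ω` is connected. -/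
structure IsLipschitzObstacle {d : ℕ} (Ω : Set (Space d)) : Prop where
  isOpen : IsOpen Ω
  isBounded : Bornology.IsBounded Ω
  lipschitz : ∀ x ∈ frontier Ω, IsLipschitzHypographAt Ω x
  connected : IsConnected (closure Ω)ᶜ

/-- Near `x`, the boundary of `Ω` is the graph of a `C²` function over a hyperplane. -/
def IsC2BoundaryAt {d : ℕ} (Ω : Set (Space d)) (x : Space d) : Prop :=
  ∃ (ν : Space d) (γ : (ℝ ∙ ν)ᗮ → ℝ), ‖ν‖ = 1 ∧ ContDiff ℝ 2 γ ∧
    ∀ᶠ y in 𝓝 x, (y ∈ frontier Ω ↔ ⟪ν, y⟫ = γ ((ℝ ∙ ν)ᗮ.orthogonalProjectionOnto y))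

/-- The boundary of `Ω` is `C²` in a neighbourhood of the set `s`. -/
def IsC2BoundaryNear {d : ℕ} (Ω s : Set (Space d)) : Prop :=
  ∃ V : Set (Space d), IsOpen V ∧ s ⊆ V ∧ ∀ x ∈ V ∩ frontier Ω, IsC2BoundaryAt Ω x

/-! ### Function spaces on the boundary and the single-layer operator -/

/-- Surface measure on `∂Ω`: the `(d-1)`-dimensional Hausdorff measure, normalised to agree
with Lebesgue measure in dimension `d - 1`, restricted to `∂Ω`. -/
def surfaceMeasure {d : ℕ} (Ω : Set (Space d)) : Measure (Space d) :=
  (μHE[d - 1] : Measure (Space d)).restrict (frontier Ω)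

/-- The single-layer operator `S_k φ(x) = ∫_{∂Ω} Φ_k(x, y) φ(y) ds(y)`. -/
def singleLayer {d : ℕ} (Ω : Set (Space d)) (k : ℝ) (φ : Space d → ℂ) (x : Space d) : ℂ :=
  ∫ y, fundamentalSolution d k x y * φ y ∂(surfaceMeasure Ω)

/-- The tangent space of `∂Ω` at `x`: the span of the tangent cone. Where `∂Ω` is
differentiable, hence at almost every point of a Lipschitz boundary, the tangent cone is already
the tangent hyperplane. -/
def tangentSpan {d : ℕ} (Ω : Set (Space d)) (x : Space d) : Submodule ℝ (Space d) :=
  Submodule.span ℝ (tangentConeAt ℝ (frontier Ω) x)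

/-- The surface gradient on `∂Ω` of (the restriction of) a differentiable complex-valued function
`u` on `ℝᵈ`: the tangential part of `∇u`. Its `j`-th component is the derivative of `u` in the
direction of the tangential part of the `j`-th coordinate vector. -/
def surfaceGradient {d : ℕ} (Ω : Set (Space d)) (u : Space d → ℂ) (x : Space d) :
    EuclideanSpace ℂ (Fin d) :=
  WithLp.toLp 2 fun j =>
    fderiv ℝ u x ((tangentSpan Ω x).starProjection (EuclideanSpace.single j 1))

/-- `v ∈ L²(∂Ω)` belongs to `H¹(∂Ω)`, with surface gradient `g ∈ L²(∂Ω)`. Here `H¹(∂Ω)` is the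
completion of the restrictions to `∂Ω` of functions in `C_c^∞(ℝᵈ)` under the norm
`(∫_{∂Ω} |∇_{∂Ω} u|² + |u|² ds)^{1/2}`: there are such functions `uₙ` with `uₙ → v` and
`∇_{∂Ω} uₙ → g` in `L²(∂Ω)`. -/
def HasSurfaceGradient {d : ℕ} (Ω : Set (Space d)) (v : Space d → ℂ)
    (g : Space d → EuclideanSpace ℂ (Fin d)) : Prop :=
  MemLp v 2 (surfaceMeasure Ω) ∧ MemLp g 2 (surfaceMeasure Ω) ∧
  ∃ u : ℕ → Space d → ℂ, (∀ n, ContDiff ℝ ∞ (u n) ∧ HasCompactSupport (u n)) ∧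
    Tendsto (fun n => eLpNorm (fun x => u n x - v x) 2 (surfaceMeasure Ω)) atTop (𝓝 0) ∧
    Tendsto (fun n => eLpNorm (fun x => surfaceGradient Ω (u n) x - g x) 2 (surfaceMeasure Ω))
      atTop (𝓝 0)

/-- The `L²(∂Ω)` norm. -/
def normL2 {d : ℕ} (Ω : Set (Space d)) (v : Space d → ℂ) : ℝ≥0∞ :=
  eLpNorm v 2 (surfaceMeasure Ω)

/-- The `H¹(∂Ω)` norm `(‖v‖² + ‖∇_{∂Ω} v‖²)^{1/2}`, which is `∞` if `v ∉ H¹(∂Ω)`. The surface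
gradient is unique up to null sets, so the infimum runs over the values for one class. -/
def normH1 {d : ℕ} (Ω : Set (Space d)) (v : Space d → ℂ) : ℝ≥0∞ :=
  ⨅ (g : Space d → EuclideanSpace ℂ (Fin d)) (_ : HasSurfaceGradient Ω v g),
    (normL2 Ω v ^ 2 + eLpNorm g 2 (surfaceMeasure Ω) ^ 2) ^ (1 / 2 : ℝ)

/-- The operator norm of `T` from `L²(∂Ω)` to the space with norm `N`, as an element of
`[0, ∞]`: the supremum of `N (T φ)` over the unit ball of `L²(∂Ω)`. -/
def opNorm {d : ℕ} (Ω : Set (Space d)) (N : (Space d → ℂ) → ℝ≥0∞)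
    (T : (Space d → ℂ) → Space d → ℂ) : ℝ≥0∞ :=
  ⨆ (φ : Space d → ℂ) (_ : MemLp φ 2 (surfaceMeasure Ω)) (_ : normL2 Ω φ ≤ 1), N (T φ)

/-- The open line segment of length `2δ` with midpoint `a` and direction `e`. -/
def lineSegment {d : ℕ} (a e : Space d) (δ : ℝ) : Set (Space d) :=
  {x | ∃ t : ℝ, |t| < δ ∧ x = a + t • e}

end Helmholtz

end

open MeasureTheory Filter Topology Set
open scoped ENNReal NNReal ContDiff RealInnerProductSpace

noncomputable section

namespace Helmholtz

/-! ### Power series with factorially decaying coefficients -/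

/-! The operator is tested on one function for each `k`: the plane wave `e^{iκ e·y}` with `|κ| = k`,
cut off to a piece `S₁` of the boundary lying along the segment and normalised in `L²`. Its
potential is observed on a second piece `S`, further along the segment and at positive distance from
`S₁`. For `x ∈ S` and `y ∈ S₁` the vector `x - y` is parallel, or nearly parallel, to `e`, so the
oscillation of the kernel cancels against that of the plane wave and the integral over `S₁` suffers
no destructive interference.

For `d = 2` both pieces are fixed subsegments and `|x - y| = e·(x - y)` exactly. What is needed is
the decay `H₀(t) ~ t^{-1/2}` with a nonzero oscillating amplitude
(`exists_hankelH0_integral_bounds`). It follows from the Bessel equation: `√t H₀(t)` solves `u'' +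
(1 + 1/(4t²)) u = 0`, whose solutions are asymptotic to combinations of `e^{±it}`, and a Grönwall
bound for the energy keeps the limiting amplitudes from both vanishing. The potential then has size
`k^{-1/2}` on a set of fixed length.

For `d = 3` the pieces are images of rectangles of fixed length and width of order `k^{-1/2}` in a
chart along the segment. At this width the phase error `k(|x - y| - e·(x - y))` stays below `1`
(`spherical_wave_bounds`), while the kernel has fixed size. Normalising the source gives a potential
of size at least a constant times the square root of the source area; taking the `L²` norm over the
target costs another square root of an area, and together these give `k^{-1/2}`.

The `H¹` bound gains a factor `k` without differentiating the potential or knowing that it lies in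
`H¹`. The potential `v` satisfies `Re(ζ v e^{-iκ e·x}) ≥ a` and `|v| ≤ b` with `b/a` bounded. For
any candidate surface gradient `g`, integration by parts along curves in the boundary against
`e^{-iκ e·x}` times a cutoff turns the pairing of the tangential derivative into an integral of `v`
against a weight of size `k` with the matching phase. That integral is of order `k a`, so `g` must
be large (`IsBoundaryStrip.le_normH1`). `IsBoundaryStrip` isolates what this argument needs of the
boundary, so both dimensions share `le_opNorm_of_strip`. -/

lemma summable_mul_pow_of_le_factorial {c : ℕ → ℝ} {K : ℝ} (hc : ∀ m, |c m| ≤ K / m.factorial)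
    (z : ℝ) : Summable fun m => c m * z ^ m := by
  refine Summable.of_norm_bounded ((Real.summable_pow_div_factorial |z|).mul_left K) fun m => ?_
  rw [Real.norm_eq_abs, abs_mul, abs_pow]
  calc |c m| * |z| ^ m ≤ K / m.factorial * |z| ^ m := by gcongr; exact hc m
    _ = K * (|z| ^ m / m.factorial) := by ring

lemma abs_succ_mul_le_factorial {c : ℕ → ℝ} {K : ℝ} (hc : ∀ m, |c m| ≤ K / m.factorial) (m : ℕ) :
    |((m : ℝ) + 1) * c (m + 1)| ≤ K / m.factorial := by
  have hm : (0 : ℝ) < m + 1 := by positivity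
  rw [abs_mul, abs_of_pos hm]
  calc ((m : ℝ) + 1) * |c (m + 1)| ≤ ((m : ℝ) + 1) * (K / ((m + 1 : ℕ).factorial : ℝ)) := by
        gcongr; exact hc _
    _ = K / m.factorial := by
      rw [Nat.factorial_succ]; push_cast; field_simp

/-- The factorial decay survives termwise differentiation, so on the interval of radius `|z| + 1`
the differentiated series has a summable majorant. -/
lemma hasDerivAt_tsum_mul_pow {c : ℕ → ℝ} {K : ℝ} (hc : ∀ m, |c m| ≤ K / m.factorial) (z : ℝ) :
    HasDerivAt (fun z => ∑' m, c m * z ^ m) (∑' m : ℕ, ((m : ℝ) + 1) * c (m + 1) * z ^ m) z := by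
  set R : ℝ := |z| + 1 with hR
  have hR0 : 0 < R := by positivity
  have hu : Summable fun n : ℕ => K / n.factorial * (n * R ^ (n - 1)) := by
    rw [← summable_nat_add_iff 1]
    refine ((Real.summable_pow_div_factorial R).mul_left K).congr fun n => ?_
    rw [Nat.factorial_succ, Nat.add_sub_cancel]
    push_cast
    field_simp
  have key := hasDerivAt_tsum_of_isPreconnected (𝕜 := ℝ) (F := ℝ) (t := Ioo (-R) R)
    (g := fun n y => c n * y ^ n) (g' := fun n y => c n * (n * y ^ (n - 1)))
    (y₀ := 0) (y := z) hu isOpen_Ioo isPreconnected_Ioo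
    (fun n y _ => (hasDerivAt_pow n y).const_mul (c n)) ?_ ?_ ?_ ?_
  · refine key.congr_deriv ?_
    have hs : Summable fun n : ℕ => c n * (n * z ^ (n - 1)) := by
      rw [← summable_nat_add_iff 1]
      refine (summable_mul_pow_of_le_factorial (abs_succ_mul_le_factorial hc) z).congr fun n => ?_
      rw [Nat.add_sub_cancel]; push_cast; ring
    rw [hs.tsum_eq_zero_add]
    simp only [Nat.cast_zero, zero_mul, mul_zero, zero_add, Nat.add_sub_cancel]
    refine tsum_congr fun n => ?_
    push_cast; ring
  · intro n y hy
    rw [Real.norm_eq_abs, abs_mul, abs_mul, abs_pow, Nat.abs_cast]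
    have : |y| ≤ R := (abs_lt.2 hy).le
    have hK := (abs_nonneg _).trans (hc n)
    gcongr
    exact hc n
  · exact ⟨by linarith, hR0⟩
  · exact summable_mul_pow_of_le_factorial hc 0
  · exact ⟨by rw [hR]; linarith [neg_abs_le z], by rw [hR]; linarith [le_abs_self z]⟩

lemma mul_tsum_succ_mul_pow {c : ℕ → ℝ} {K : ℝ} (hc : ∀ m, |c m| ≤ K / m.factorial) (z : ℝ) :
    z * ∑' m : ℕ, ((m : ℝ) + 1) * c (m + 1) * z ^ m = ∑' m : ℕ, (m : ℝ) * c m * z ^ m := by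
  have hs := summable_mul_pow_of_le_factorial (abs_succ_mul_le_factorial hc) z
  have hs' : Summable fun m : ℕ => (m : ℝ) * c m * z ^ m := by
    rw [← summable_nat_add_iff 1]
    refine (hs.mul_left z).congr fun n => ?_
    push_cast; ring
  rw [hs'.tsum_eq_zero_add, ← tsum_mul_left]
  simp only [Nat.cast_zero, zero_mul, zero_add]
  refine tsum_congr fun n => ?_
  push_cast; ring

/-! ### The Bessel differential equation -/

/-- Coefficients of the series of `J₀` in the variable `t² / 4`. -/
def coeffJ (m : ℕ) : ℝ := (-1) ^ m / (m.factorial : ℝ) ^ 2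

/-- Coefficients of the logarithm-free part of `Y₀` in the variable `t² / 4`. -/
def coeffY (m : ℕ) : ℝ := (-1) ^ m * (harmonic m : ℝ) / (m.factorial : ℝ) ^ 2

lemma abs_coeffJ_le (m : ℕ) : |coeffJ m| ≤ 1 / m.factorial := by
  have h1 : (1 : ℝ) ≤ m.factorial := by exact_mod_cast m.factorial_pos
  rw [coeffJ, abs_div, abs_pow, abs_neg, abs_one, one_pow, abs_of_nonneg (by positivity)]
  exact one_div_le_one_div_of_le (by positivity) (by nlinarith)

lemma harmonic_le_self (m : ℕ) : (harmonic m : ℝ) ≤ m := by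
  induction m with
  | zero => simp
  | succ n ih =>
    rw [harmonic_succ]
    push_cast
    have : ((n : ℝ) + 1)⁻¹ ≤ 1 := inv_le_one_of_one_le₀ (by linarith [n.cast_nonneg (α := ℝ)])
    linarith

lemma harmonic_nonneg (m : ℕ) : (0 : ℝ) ≤ harmonic m := by
  induction m with
  | zero => simp
  | succ n ih => rw [harmonic_succ]; push_cast; positivity

lemma abs_coeffY_le (m : ℕ) : |coeffY m| ≤ 1 / m.factorial := by
  have h0 : (0 : ℝ) < m.factorial := by exact_mod_cast m.factorial_pos
  have h1 : (harmonic m : ℝ) ≤ m.factorial :=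
    (harmonic_le_self m).trans (by exact_mod_cast m.self_le_factorial)
  rw [coeffY, abs_div, abs_mul, abs_pow, abs_neg, abs_one, one_pow, one_mul,
    abs_of_nonneg (harmonic_nonneg m), abs_of_pos (by positivity), div_le_div_iff₀ (by positivity) h0]
  nlinarith

/-- Shift of a coefficient sequence by differentiation of its power series. -/
def derivCoeff (c : ℕ → ℝ) (m : ℕ) : ℝ := ((m : ℝ) + 1) * c (m + 1)

lemma sq_succ_mul_coeffJ (m : ℕ) : ((m : ℝ) + 1) ^ 2 * coeffJ (m + 1) = -coeffJ m := by
  rw [coeffJ, coeffJ, Nat.factorial_succ]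
  push_cast
  field_simp
  ring

/-- The increment `1/(m+1)` of the harmonic number is the only deviation from the recursion of
`coeffJ`. It produces the source term `F'`, which later cancels the cross term from differentiating
`log` times `J₀`. -/
lemma sq_succ_mul_coeffY (m : ℕ) :
    ((m : ℝ) + 1) ^ 2 * coeffY (m + 1) = -coeffY m + derivCoeff coeffJ m := by
  rw [coeffY, coeffY, derivCoeff, coeffJ, Nat.factorial_succ, harmonic_succ]
  push_cast
  field_simp
  ring

/-- The sum of the power series with coefficients `c`. -/
def powSum (c : ℕ → ℝ) (z : ℝ) : ℝ := ∑' m, c m * z ^ m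

lemma hasDerivAt_powSum {c : ℕ → ℝ} {K : ℝ} (hc : ∀ m, |c m| ≤ K / m.factorial) (z : ℝ) :
    HasDerivAt (powSum c) (powSum (derivCoeff c) z) z :=
  hasDerivAt_tsum_mul_pow hc z

lemma abs_derivCoeff_le {c : ℕ → ℝ} {K : ℝ} (hc : ∀ m, |c m| ≤ K / m.factorial) (m : ℕ) :
    |derivCoeff c m| ≤ K / m.factorial :=
  abs_succ_mul_le_factorial hc m

/-- If `(m + 1)² c_{m+1} = -c_m + b_m`, the power series `F` of `c` and `B` of `b` satisfy
`z F'' + F' + F = B`. -/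
lemma powSum_ode {c b : ℕ → ℝ} {K L : ℝ} (hc : ∀ m, |c m| ≤ K / m.factorial)
    (hb : ∀ m, |b m| ≤ L / m.factorial)
    (h : ∀ m : ℕ, ((m : ℝ) + 1) ^ 2 * c (m + 1) = -c m + b m) (z : ℝ) :
    z * powSum (derivCoeff (derivCoeff c)) z + powSum (derivCoeff c) z + powSum c z
      = powSum b z := by
  have h1 := abs_derivCoeff_le hc
  have e : z * powSum (derivCoeff (derivCoeff c)) z = ∑' m : ℕ, (m : ℝ) * derivCoeff c m * z ^ m :=
    mul_tsum_succ_mul_pow h1 z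
  have s0 := summable_mul_pow_of_le_factorial hc z
  have s1 := summable_mul_pow_of_le_factorial h1 z
  have sb := summable_mul_pow_of_le_factorial hb z
  have hterm : ∀ m : ℕ, (m : ℝ) * derivCoeff c m * z ^ m
      = b m * z ^ m - c m * z ^ m - derivCoeff c m * z ^ m := by
    intro m
    have := h m
    rw [derivCoeff]
    linear_combination z ^ m * this
  rw [e, tsum_congr hterm, (sb.sub s0).tsum_sub s1, sb.tsum_sub s0]
  simp only [powSum]
  ring

lemma besselJ0_eq (t : ℝ) : besselJ0 t = powSum coeffJ (t ^ 2 / 4) :=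
  tsum_congr fun m => by rw [coeffJ]; ring

lemma besselY0_eq (t : ℝ) : besselY0 t = 2 / Real.pi *
    (Real.log (t / 2) + Real.eulerMascheroniConstant) * powSum coeffJ (t ^ 2 / 4)
      - 2 / Real.pi * powSum coeffY (t ^ 2 / 4) := by
  rw [besselY0, besselJ0_eq]
  congr 2
  exact tsum_congr fun m => by rw [coeffY]; ring

lemma hasDerivAt_powSum_sq {c : ℕ → ℝ} {K : ℝ} (hc : ∀ m, |c m| ≤ K / m.factorial) (t : ℝ) :
    HasDerivAt (fun t => powSum c (t ^ 2 / 4)) (t / 2 * powSum (derivCoeff c) (t ^ 2 / 4)) t := by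
  have := (hasDerivAt_powSum hc (t ^ 2 / 4)).comp t ((hasDerivAt_pow 2 t).div_const 4)
  refine this.congr_deriv ?_
  push_cast; ring

/-- The derivative of `besselJ0`. -/
def besselJ0Deriv (t : ℝ) : ℝ := t / 2 * powSum (derivCoeff coeffJ) (t ^ 2 / 4)

/-- The derivative of `besselY0`. -/
def besselY0Deriv (t : ℝ) : ℝ :=
  2 / Real.pi * (t⁻¹ * powSum coeffJ (t ^ 2 / 4)
      + (Real.log (t / 2) + Real.eulerMascheroniConstant) *
        (t / 2 * powSum (derivCoeff coeffJ) (t ^ 2 / 4))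
      - t / 2 * powSum (derivCoeff coeffY) (t ^ 2 / 4))

lemma hasDerivAt_log_half {t : ℝ} (ht : 0 < t) :
    HasDerivAt (fun t => Real.log (t / 2) + Real.eulerMascheroniConstant) t⁻¹ t := by
  have := (((hasDerivAt_id t).div_const 2).log (by simp; linarith)).add_const
    Real.eulerMascheroniConstant
  refine this.congr_deriv ?_
  simp only [id]
  field_simp

lemma hasDerivAt_half_mul_powSum_sq {c : ℕ → ℝ} {K : ℝ} (hc : ∀ m, |c m| ≤ K / m.factorial)
    (t : ℝ) : HasDerivAt (fun t => t / 2 * powSum c (t ^ 2 / 4))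
      (1 / 2 * powSum c (t ^ 2 / 4) + t ^ 2 / 4 * powSum (derivCoeff c) (t ^ 2 / 4)) t := by
  refine (((hasDerivAt_id t).div_const 2).mul (hasDerivAt_powSum_sq hc t)).congr_deriv ?_
  simp only [id]
  ring

lemma hasDerivAt_besselJ0 (t : ℝ) : HasDerivAt besselJ0 (besselJ0Deriv t) t :=
  (hasDerivAt_powSum_sq abs_coeffJ_le t).congr_of_eventuallyEq
    (Eventually.of_forall besselJ0_eq)

lemma hasDerivAt_besselY0 {t : ℝ} (ht : 0 < t) : HasDerivAt besselY0 (besselY0Deriv t) t := by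
  have h2 := (((hasDerivAt_log_half ht).mul (hasDerivAt_powSum_sq abs_coeffJ_le t)).sub
    (hasDerivAt_powSum_sq abs_coeffY_le t)).const_mul (2 / Real.pi)
  refine h2.congr_of_eventuallyEq (Eventually.of_forall fun s => ?_)
  simp only [besselY0_eq, Pi.mul_apply, Pi.sub_apply]
  ring

/-- Under `z = t²/4` the equation `z F'' + F' + F = 0` becomes Bessel's equation of order zero. -/
lemma besselJ0_ode {t : ℝ} (ht : 0 < t) :
    HasDerivAt besselJ0Deriv (-besselJ0 t - besselJ0Deriv t / t) t := by
  refine (hasDerivAt_half_mul_powSum_sq (abs_derivCoeff_le abs_coeffJ_le) t).congr_deriv ?_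
  have odeJ := powSum_ode (b := 0) (L := 0) abs_coeffJ_le (by simp)
    (by simpa using sq_succ_mul_coeffJ) (t ^ 2 / 4)
  have hb0 : powSum 0 (t ^ 2 / 4) = 0 := by simp [powSum]
  rw [hb0] at odeJ
  rw [besselJ0_eq, besselJ0Deriv]
  field_simp
  linear_combination 8 * odeJ

lemma besselY0_ode {t : ℝ} (ht : 0 < t) :
    HasDerivAt besselY0Deriv (-besselY0 t - besselY0Deriv t / t) t := by
  have hJ' := hasDerivAt_half_mul_powSum_sq (abs_derivCoeff_le abs_coeffJ_le) t
  have hY' := hasDerivAt_half_mul_powSum_sq (abs_derivCoeff_le abs_coeffY_le) t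
  have hinv := (hasDerivAt_inv ht.ne').mul (hasDerivAt_powSum_sq abs_coeffJ_le t)
  have h2 := (((hinv).add ((hasDerivAt_log_half ht).mul hJ')).sub hY').const_mul (2 / Real.pi)
  refine h2.congr_deriv ?_
  have odeJ := powSum_ode (b := 0) (L := 0) abs_coeffJ_le (by simp)
    (by simpa using sq_succ_mul_coeffJ) (t ^ 2 / 4)
  have odeY := powSum_ode abs_coeffY_le (abs_derivCoeff_le abs_coeffJ_le)
    sq_succ_mul_coeffY (t ^ 2 / 4)
  have hb0 : powSum 0 (t ^ 2 / 4) = 0 := by simp [powSum]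
  rw [hb0] at odeJ
  rw [besselY0_eq, besselY0Deriv]
  generalize Real.log (t / 2) + Real.eulerMascheroniConstant = ℓ
  generalize powSum coeffJ (t ^ 2 / 4) = F at *
  generalize powSum coeffY (t ^ 2 / 4) = G at *
  generalize powSum (derivCoeff coeffJ) (t ^ 2 / 4) = F' at *
  generalize powSum (derivCoeff coeffY) (t ^ 2 / 4) = G' at *
  generalize powSum (derivCoeff (derivCoeff coeffJ)) (t ^ 2 / 4) = F'' at *
  generalize powSum (derivCoeff (derivCoeff coeffY)) (t ^ 2 / 4) = G'' at *
  have hpi := Real.pi_ne_zero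
  field_simp
  linear_combination 8 * t ^ 2 * ℓ * odeJ - 8 * t ^ 2 * odeY

/-- The derivative of `hankelH0`. -/
def hankelDeriv (t : ℝ) : ℂ := (besselJ0Deriv t : ℂ) + Complex.I * (besselY0Deriv t : ℂ)

lemma hasDerivAt_hankelH0 {t : ℝ} (ht : 0 < t) : HasDerivAt hankelH0 (hankelDeriv t) t :=
  (hasDerivAt_besselJ0 t).ofReal_comp.add
    ((hasDerivAt_besselY0 ht).ofReal_comp.const_mul Complex.I)

lemma hankelH0_ode {t : ℝ} (ht : 0 < t) :
    HasDerivAt hankelDeriv (-hankelH0 t - hankelDeriv t / t) t := by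
  refine ((besselJ0_ode ht).ofReal_comp.add
    ((besselY0_ode ht).ofReal_comp.const_mul Complex.I)).congr_deriv ?_
  rw [hankelH0, hankelDeriv]
  push_cast
  ring

/-- The real part tends to `J₀(0) = 1` at the origin. A single nonzero value gives positive initial
energy, which is what keeps the amplitudes at infinity from vanishing. -/
lemma exists_hankelH0_ne_zero : ∃ t > 0, hankelH0 t ≠ 0 := by
  have hc : ContinuousAt besselJ0 0 := (hasDerivAt_besselJ0 0).continuousAt
  have h0 : besselJ0 0 = 1 := by
    rw [besselJ0, tsum_eq_single 0 (fun m hm => by simp [hm])]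
    simp
  have h1 : ∀ᶠ t in 𝓝 (0 : ℝ), 0 < besselJ0 t := hc.eventually (lt_mem_nhds (by rw [h0]; norm_num))
  obtain ⟨t, ht, ht0⟩ :=
    ((h1.filter_mono nhdsWithin_le_nhds).and (self_mem_nhdsWithin : Ioi (0 : ℝ) ∈ 𝓝[>] 0)).exists
  refine ⟨t, ht0, fun h => ht.ne' ?_⟩
  have := congrArg Complex.re h
  simpa [hankelH0] using this

/-! ### Asymptotics at infinity of solutions of `u'' + (1 + 1/(4t²)) u = 0` -/

section Asymptotics

variable {u u' : ℝ → ℂ}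

/-- The energy is conserved by `u'' + u = 0`, so only the perturbation `1/(4t²)` contributes to its
derivative. -/
lemma energy_hasDerivAt {t : ℝ} (hu : HasDerivAt u (u' t) t)
    (hu' : HasDerivAt u' (-(1 + 1 / (4 * (t : ℂ) ^ 2)) * u t) t) :
    HasDerivAt (fun t => ‖u t‖ ^ 2 + ‖u' t‖ ^ 2) (-(1 / (2 * t ^ 2)) * ⟪u' t, u t⟫) t := by
  refine (hu.norm_sq.add hu'.norm_sq).congr_deriv ?_
  have : -(1 + 1 / (4 * (t : ℂ) ^ 2)) * u t = (-(1 + 1 / (4 * t ^ 2)) : ℝ) • u t := by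
    rw [Complex.real_smul]; push_cast; rfl
  rw [this, inner_smul_right, real_inner_comm]
  ring

lemma abs_energy_deriv_le (t : ℝ) (z w : ℂ) :
    |-(1 / (2 * t ^ 2)) * ⟪w, z⟫| ≤ 1 / (4 * t ^ 2) * (‖z‖ ^ 2 + ‖w‖ ^ 2) := by
  rw [abs_mul, abs_neg, abs_of_nonneg (by positivity)]
  have h1 : |⟪w, z⟫| ≤ (‖z‖ ^ 2 + ‖w‖ ^ 2) / 2 := by
    have := abs_real_inner_le_norm w z
    nlinarith [sq_nonneg (‖z‖ - ‖w‖)]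
  calc 1 / (2 * t ^ 2) * |⟪w, z⟫| ≤ 1 / (2 * t ^ 2) * ((‖z‖ ^ 2 + ‖w‖ ^ 2) / 2) := by gcongr
    _ = _ := by ring

lemma hasDerivAt_exp_inv (s : ℝ) {t : ℝ} (ht : 0 < t) :
    HasDerivAt (fun t : ℝ => Real.exp (s / (4 * t))) (-(s / (4 * t ^ 2)) * Real.exp (s / (4 * t)))
      t := by
  have h := ((hasDerivAt_inv ht.ne').const_mul (s / 4)).exp
  refine (h.congr_deriv ?_).congr_of_eventuallyEq (Eventually.of_forall fun x => ?_)
  · rw [show s / 4 * t⁻¹ = s / (4 * t) by field_simp]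
    field_simp
  · beta_reduce
    congr 1
    by_cases hx : x = 0
    · simp [hx]
    · field_simp

/-- Grönwall: the energy changes at relative rate at most `1/(4t²)`, which is minus the logarithmic
derivative of `exp(1/(4t))`. Since this rate is integrable at infinity, the energy stays bounded. -/
lemma energy_antitoneOn (hu : ∀ t : ℝ, 0 < t → HasDerivAt u (u' t) t)
    (hu' : ∀ t : ℝ, 0 < t → HasDerivAt u' (-(1 + 1 / (4 * (t : ℂ) ^ 2)) * u t) t) :
    AntitoneOn (fun t => (‖u t‖ ^ 2 + ‖u' t‖ ^ 2) * Real.exp (1 / (4 * t))) (Ioi 0) := by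
  have hd : ∀ t ∈ Ioi (0 : ℝ), HasDerivAt
      (fun t => (‖u t‖ ^ 2 + ‖u' t‖ ^ 2) * Real.exp (1 / (4 * t))) _ t := fun t ht =>
    (energy_hasDerivAt (hu t ht) (hu' t ht)).mul (hasDerivAt_exp_inv 1 ht)
  refine antitoneOn_of_hasDerivWithinAt_nonpos (convex_Ioi 0)
    (fun t ht => (hd t ht).continuousAt.continuousWithinAt)
    (fun t ht => (hd t (interior_subset ht)).hasDerivWithinAt) fun t ht => ?_
  have := (abs_le.1 (abs_energy_deriv_le t (u t) (u' t))).2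
  nlinarith [Real.exp_pos (1 / (4 * t))]

/-- The same estimate with the opposite sign; it bounds the energy away from zero at infinity. -/
lemma energy_monotoneOn (hu : ∀ t : ℝ, 0 < t → HasDerivAt u (u' t) t)
    (hu' : ∀ t : ℝ, 0 < t → HasDerivAt u' (-(1 + 1 / (4 * (t : ℂ) ^ 2)) * u t) t) :
    MonotoneOn (fun t => (‖u t‖ ^ 2 + ‖u' t‖ ^ 2) * Real.exp (-1 / (4 * t))) (Ioi 0) := by
  have hd : ∀ t ∈ Ioi (0 : ℝ), HasDerivAt
      (fun t => (‖u t‖ ^ 2 + ‖u' t‖ ^ 2) * Real.exp (-1 / (4 * t))) _ t := fun t ht =>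
    (energy_hasDerivAt (hu t ht) (hu' t ht)).mul (hasDerivAt_exp_inv (-1) ht)
  refine monotoneOn_of_hasDerivWithinAt_nonneg (convex_Ioi 0)
    (fun t ht => (hd t ht).continuousAt.continuousWithinAt)
    (fun t ht => (hd t (interior_subset ht)).hasDerivWithinAt) fun t ht => ?_
  have := (abs_le.1 (abs_energy_deriv_le t (u t) (u' t))).1
  have h2 : -1 / (4 * t ^ 2) = -(1 / (4 * t ^ 2)) := by ring
  rw [h2]
  nlinarith [Real.exp_pos (-1 / (4 * t))]

lemma exists_tendsto_of_norm_deriv_le_inv_sq {f f' : ℝ → ℂ} {a C : ℝ} (ha : 0 < a)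
    (hf : ∀ t, a ≤ t → HasDerivAt f (f' t) t) (hc : ContinuousOn f' (Ici a))
    (hb : ∀ t, a ≤ t → ‖f' t‖ ≤ C / t ^ 2) : ∃ A, Tendsto f atTop (𝓝 A) := by
  refine ⟨_, MeasureTheory.tendsto_limUnder_of_hasDerivAt_of_integrableOn_Ioi (a := a) (f' := f')
    (fun t ht => hf t (le_of_lt ht)) ?_⟩
  have hi : IntegrableOn (fun t : ℝ => C * t ^ (-2 : ℝ)) (Ioi a) :=
    (integrableOn_Ioi_rpow_of_lt (by norm_num) ha).const_mul C
  refine Integrable.mono' hi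
    ((hc.mono Ioi_subset_Ici_self).aestronglyMeasurable measurableSet_Ioi) ?_
  refine (ae_restrict_iff' measurableSet_Ioi).2 (Eventually.of_forall fun t ht => ?_)
  have ht0 : 0 < t := ha.trans ht
  refine (hb t (le_of_lt ht)).trans_eq ?_
  rw [Real.rpow_neg ht0.le, Real.rpow_two, div_eq_mul_inv]

/-- Variation of constants: `p` and `q` are the coefficients of `e^{it}` and `e^{-it}` in `u`. Their
derivatives are `O(t⁻²)` because `u` is bounded, so both converge. -/
lemma exists_plane_wave_asymptotics (hu : ∀ t : ℝ, 0 < t → HasDerivAt u (u' t) t)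
    (hu' : ∀ t : ℝ, 0 < t → HasDerivAt u' (-(1 + 1 / (4 * (t : ℂ) ^ 2)) * u t) t)
    {t₀ : ℝ} (ht₀ : 0 < t₀) (hne : u t₀ ≠ 0) :
    ∃ A B : ℂ, (A ≠ 0 ∨ B ≠ 0) ∧ Tendsto (fun t : ℝ => u t - A * Complex.exp (Complex.I * t)
      - B * Complex.exp (-(Complex.I * t))) atTop (𝓝 0) := by
  set p : ℝ → ℂ := fun t => Complex.exp (-(Complex.I * t)) * (u t - Complex.I * u' t) / 2
  set q : ℝ → ℂ := fun t => Complex.exp (Complex.I * t) * (u t + Complex.I * u' t) / 2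
  have hI : ∀ t : ℝ, HasDerivAt (fun t : ℝ => Complex.I * (t : ℂ)) Complex.I t := fun t => by
    simpa using (Complex.ofRealCLM.hasDerivAt (x := t)).const_mul Complex.I
  set p' : ℝ → ℂ := fun t => Complex.I / (8 * (t : ℂ) ^ 2) * Complex.exp (-(Complex.I * t)) * u t
  set q' : ℝ → ℂ := fun t => -Complex.I / (8 * (t : ℂ) ^ 2) * Complex.exp (Complex.I * t) * u t
  have hp : ∀ t, 0 < t → HasDerivAt p (p' t) t := fun t ht => by
    have htc : (t : ℂ) ≠ 0 := by exact_mod_cast ht.ne'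
    refine (((hI t).neg.cexp.mul ((hu t ht).sub ((hu' t ht).const_mul Complex.I))).div_const
      2).congr_deriv ?_
    simp only [p', Pi.neg_apply, Pi.sub_apply]
    field_simp
    ring_nf
    simp only [Complex.I_sq]
    ring
  have hq : ∀ t, 0 < t → HasDerivAt q (q' t) t := fun t ht => by
    have htc : (t : ℂ) ≠ 0 := by exact_mod_cast ht.ne'
    refine (((hI t).cexp.mul ((hu t ht).add ((hu' t ht).const_mul Complex.I))).div_const
      2).congr_deriv ?_
    simp only [q', Pi.add_apply]
    field_simp
    ring_nf
    simp only [Complex.I_sq]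
    ring
  set e₁ := (‖u t₀‖ ^ 2 + ‖u' t₀‖ ^ 2) * Real.exp (1 / (4 * t₀))
  set e₀ := (‖u t₀‖ ^ 2 + ‖u' t₀‖ ^ 2) * Real.exp (-1 / (4 * t₀))
  have he₀ : 0 < e₀ := by positivity
  have hup : ∀ t, t₀ ≤ t → ‖u t‖ ^ 2 + ‖u' t‖ ^ 2 ≤ e₁ := fun t ht => by
    refine le_trans ?_ (energy_antitoneOn hu hu' ht₀ (ht₀.trans_le ht : 0 < t) ht)
    refine le_mul_of_one_le_right (by positivity) (Real.one_le_exp ?_)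
    have := ht₀.trans_le ht
    positivity
  have hlow : ∀ t, t₀ ≤ t → e₀ ≤ ‖u t‖ ^ 2 + ‖u' t‖ ^ 2 := fun t ht => by
    refine (energy_monotoneOn hu hu' ht₀ (ht₀.trans_le ht : 0 < t) ht).trans ?_
    refine mul_le_of_le_one_right (by positivity) (Real.exp_le_one_iff.2 ?_)
    have := ht₀.trans_le ht
    rw [neg_div]
    exact neg_nonpos.2 (by positivity)
  have hunorm : ∀ t, t₀ ≤ t → ‖u t‖ ≤ √e₁ := fun t ht =>
    Real.le_sqrt_of_sq_le (by nlinarith [hup t ht, sq_nonneg ‖u' t‖])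
  have hcu : ContinuousOn u (Ici t₀) := fun t ht =>
    (hu t (ht₀.trans_le ht)).continuousAt.continuousWithinAt
  have hct : ∀ t ∈ Ici t₀, (8 * (t : ℂ) ^ 2) ≠ 0 := fun t ht => by
    have : (t : ℂ) ≠ 0 := by exact_mod_cast (ht₀.trans_le ht).ne'
    simp [this]
  have hn1 : ∀ t : ℝ, ‖Complex.exp (-(Complex.I * t))‖ = 1 := fun t => by
    rw [Complex.norm_exp]; simp
  have hn2 : ∀ t : ℝ, ‖Complex.exp (Complex.I * t)‖ = 1 := fun t => by
    rw [Complex.norm_exp]; simp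
  obtain ⟨A, hA⟩ := exists_tendsto_of_norm_deriv_le_inv_sq (f' := p') (C := √e₁ / 8) ht₀
    (fun t ht => hp t (ht₀.trans_le ht))
    (by
      refine ContinuousOn.mul (ContinuousOn.mul (ContinuousOn.div (by fun_prop) (by fun_prop) hct)
        (by fun_prop)) hcu)
    (fun t ht => by
      simp only [p', norm_mul, hn1, norm_div, Complex.norm_I, norm_pow, Complex.norm_real,
        Real.norm_eq_abs, sq_abs, mul_one, Complex.norm_ofNat]
      calc 1 / (8 * t ^ 2) * ‖u t‖ ≤ 1 / (8 * t ^ 2) * √e₁ := by gcongr; exact hunorm t ht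
        _ = _ := by ring)
  obtain ⟨B, hB⟩ := exists_tendsto_of_norm_deriv_le_inv_sq (f' := q') (C := √e₁ / 8) ht₀
    (fun t ht => hq t (ht₀.trans_le ht))
    (by
      refine ContinuousOn.mul (ContinuousOn.mul (ContinuousOn.div (by fun_prop) (by fun_prop) hct)
        (by fun_prop)) hcu)
    (fun t ht => by
      simp only [q', norm_mul, hn2, norm_div, norm_neg, Complex.norm_I, norm_pow,
        Complex.norm_real, Real.norm_eq_abs, sq_abs, mul_one, Complex.norm_ofNat]
      calc 1 / (8 * t ^ 2) * ‖u t‖ ≤ 1 / (8 * t ^ 2) * √e₁ := by gcongr; exact hunorm t ht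
        _ = _ := by ring)
  have hpq : ∀ t : ℝ, ‖p t‖ ^ 2 + ‖q t‖ ^ 2 = (‖u t‖ ^ 2 + ‖u' t‖ ^ 2) / 2 := fun t => by
    simp only [p, q, norm_div, norm_mul, hn1, hn2, one_mul, Complex.norm_ofNat]
    have := parallelogram_law_with_norm ℝ (u t) (Complex.I * u' t)
    have hI' : ‖Complex.I * u' t‖ = ‖u' t‖ := by simp
    rw [hI'] at this
    linear_combination this / 4
  -- By the parallelogram law `|p|² + |q|²` is half the energy, so the lower energy bound passes to
  -- the limits `A` and `B`.
  have hAB : e₀ / 2 ≤ ‖A‖ ^ 2 + ‖B‖ ^ 2 := by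
    refine ge_of_tendsto ((hA.norm.pow 2).add (hB.norm.pow 2)) ?_
    filter_upwards [eventually_ge_atTop t₀] with t ht
    rw [hpq]
    linarith [hlow t ht]
  refine ⟨A, B, ?_, ?_⟩
  · by_contra! h
    rw [h.1, h.2] at hAB
    norm_num at hAB
    linarith
  · have h1 : Tendsto (fun t : ℝ => (p t - A) * Complex.exp (Complex.I * t)) atTop (𝓝 0) := by
      refine squeeze_zero_norm (fun t => ?_) (tendsto_zero_iff_norm_tendsto_zero.1
        (tendsto_sub_nhds_zero_iff.2 hA))
      rw [norm_mul, hn2, mul_one]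
    have h2 : Tendsto (fun t : ℝ => (q t - B) * Complex.exp (-(Complex.I * t))) atTop (𝓝 0) := by
      refine squeeze_zero_norm (fun t => ?_) (tendsto_zero_iff_norm_tendsto_zero.1
        (tendsto_sub_nhds_zero_iff.2 hB))
      rw [norm_mul, hn1, mul_one]
    have h3 := h1.add h2
    rw [add_zero] at h3
    refine h3.congr fun t => ?_
    have he : Complex.exp (-(Complex.I * t)) * Complex.exp (Complex.I * t) = 1 := by
      rw [← Complex.exp_add]; simp
    simp only [p, q]
    linear_combination (u t) * he

end Asymptotics

/-- The factor `√t` removes the first-order term of Bessel's equation and leaves `u'' + (1 +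
1/(4t²)) u = 0`. The values of `A` and `B` are not needed, only that one of them is nonzero. -/
lemma exists_hankelH0_asymptotics : ∃ A B : ℂ, (A ≠ 0 ∨ B ≠ 0) ∧
    Tendsto (fun t : ℝ => (√t : ℂ) * hankelH0 t - A * Complex.exp (Complex.I * t)
      - B * Complex.exp (-(Complex.I * t))) atTop (𝓝 0) := by
  obtain ⟨t₀, ht₀, hne⟩ := exists_hankelH0_ne_zero
  refine exists_plane_wave_asymptotics (u := fun t => (√t : ℂ) * hankelH0 t)
    (u' := fun t => (1 / (2 * √t) : ℝ) * hankelH0 t + (√t : ℂ) * hankelDeriv t)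
    (fun t ht => ((Real.hasDerivAt_sqrt ht.ne').ofReal_comp).mul (hasDerivAt_hankelH0 ht))
    (fun t ht => ?_) ht₀ (mul_ne_zero (by simpa using (Real.sqrt_pos.2 ht₀).ne') hne)
  have hs := Real.hasDerivAt_sqrt ht.ne'
  have hs0 : √t ≠ 0 := (Real.sqrt_pos.2 ht).ne'
  have hinv := (hs.const_mul 2).inv (by positivity)
  have h := (hinv.ofReal_comp.mul (hasDerivAt_hankelH0 ht)).add
    (hs.ofReal_comp.mul (hankelH0_ode ht))
  refine (h.congr_deriv ?_).congr_of_eventuallyEq (Eventually.of_forall fun x => ?_)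
  · have ht2 : (t : ℂ) = (√t : ℂ) ^ 2 := by rw [← Complex.ofReal_pow, Real.sq_sqrt ht.le]
    have hsc : (√t : ℂ) ≠ 0 := by exact_mod_cast hs0
    simp only [Pi.inv_apply]
    push_cast
    rw [ht2]
    field_simp
    ring
  · simp

/-- For a suitable sign `s`, the non-oscillating part of `√t e^{-ist} H₀(t)` does not vanish at
infinity. -/
lemma exists_hankelH0_modulated : ∃ (s : ℝ) (D D' : ℂ), |s| = 1 ∧ D ≠ 0 ∧
    Tendsto (fun t : ℝ => (√t : ℂ) * hankelH0 t * Complex.exp (-(Complex.I * (s * t)))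
      - D - D' * Complex.exp (-(Complex.I * (2 * s * t)))) atTop (𝓝 0) := by
  obtain ⟨A, B, hAB, hlim⟩ := exists_hankelH0_asymptotics
  have key : ∀ s : ℝ, Tendsto (fun t : ℝ => ((√t : ℂ) * hankelH0 t
      - A * Complex.exp (Complex.I * t) - B * Complex.exp (-(Complex.I * t))) *
      Complex.exp (-(Complex.I * (s * t)))) atTop (𝓝 0) := fun s => by
    refine squeeze_zero_norm (fun t => ?_) (tendsto_zero_iff_norm_tendsto_zero.1 hlim)
    have : ‖Complex.exp (-(Complex.I * (s * t)))‖ = 1 := by rw [Complex.norm_exp]; simp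
    rw [norm_mul, this, mul_one]
  rcases hAB with h | h
  -- The sign `s` is chosen so that multiplication by `e^{-ist}` makes a nonvanishing amplitude
  -- stationary; the other wave then oscillates at frequency `2`.
  · refine ⟨1, A, B, by simp, h, (key 1).congr fun t => ?_⟩
    have e1 : Complex.exp (Complex.I * t) * Complex.exp (-(Complex.I * ((1 : ℝ) * t))) = 1 := by
      rw [← Complex.exp_add]; simp
    have e2 : Complex.exp (-(Complex.I * t)) * Complex.exp (-(Complex.I * ((1 : ℝ) * t)))
        = Complex.exp (-(Complex.I * (2 * (1 : ℝ) * t))) := by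
      rw [← Complex.exp_add]; congr 1; push_cast; ring
    linear_combination (-A) * e1 - B * e2
  · refine ⟨-1, B, A, by simp, h, (key (-1)).congr fun t => ?_⟩
    have e1 : Complex.exp (-(Complex.I * t)) * Complex.exp (-(Complex.I * ((-1 : ℝ) * t))) = 1 := by
      rw [← Complex.exp_add]; simp
    have e2 : Complex.exp (Complex.I * t) * Complex.exp (-(Complex.I * ((-1 : ℝ) * t)))
        = Complex.exp (-(Complex.I * (2 * (-1 : ℝ) * t))) := by
      rw [← Complex.exp_add]; congr 1; push_cast; ring
    linear_combination (-B) * e1 - A * e2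

/-! ### Integrals of the Hankel function against plane waves -/

lemma norm_exp_neg_I_mul_ofReal (x : ℝ) : ‖Complex.exp (-(Complex.I * x))‖ = 1 := by
  rw [Complex.norm_exp]; simp

lemma hasDerivAt_inv_sqrt {r : ℝ} (hr : 0 < r) :
    HasDerivAt (fun r => (√r)⁻¹) (-(1 / (2 * √r)) / √r ^ 2) r :=
  (Real.hasDerivAt_sqrt hr.ne').inv (Real.sqrt_pos.2 hr).ne'

/-- One integration by parts gains the factor `1/|b|`. The constant involves only `r₀` and `ℓ`, so
the bound is uniform in the left endpoint `l`. -/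
lemma norm_integral_inv_sqrt_mul_exp_le {r₀ l ℓ b : ℝ} (hr₀ : 0 < r₀) (hl : r₀ ≤ l) (hℓ : 0 ≤ ℓ)
    (hb : b ≠ 0) :
    ‖∫ r in l..l + ℓ, ((√r)⁻¹ : ℝ) * Complex.exp (-(Complex.I * (b * r : ℝ)))‖ ≤
      (2 * (√r₀)⁻¹ + ℓ * (1 / (2 * √r₀) / √r₀ ^ 2)) / |b| := by
  have hs₀ : 0 < √r₀ := Real.sqrt_pos.2 hr₀
  have hpos : ∀ r ∈ uIcc l (l + ℓ), r₀ ≤ r := fun r hr => by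
    rw [uIcc_of_le (by linarith)] at hr
    exact hl.trans hr.1
  have hbc : (b : ℂ) ≠ 0 := by exact_mod_cast hb
  set g : ℝ → ℂ := fun r => Complex.exp (-(Complex.I * (b * r : ℝ))) * (Complex.I / b)
  have hgn : ∀ r, ‖g r‖ = 1 / |b| := fun r => by
    simp only [g, norm_mul, norm_exp_neg_I_mul_ofReal, norm_div, Complex.norm_I, Complex.norm_real,
      Real.norm_eq_abs, one_mul]
  have hg : ∀ r : ℝ, HasDerivAt g (Complex.exp (-(Complex.I * (b * r : ℝ)))) r := fun r => by
    have h1 : HasDerivAt (fun r : ℝ => -(Complex.I * ((b * r : ℝ) : ℂ))) (-(Complex.I * (b : ℂ))) r := by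
      have := ((((hasDerivAt_id r).const_mul b).ofReal_comp).const_mul Complex.I).neg
      refine this.congr_deriv ?_
      simp
    refine (h1.cexp.mul_const (Complex.I / b)).congr_deriv ?_
    field_simp
    simp
  have hparts := intervalIntegral.integral_mul_deriv_eq_deriv_mul
    (a := l) (b := l + ℓ) (u := fun r : ℝ => (((√r)⁻¹ : ℝ) : ℂ))
    (u' := fun r : ℝ => ((-(1 / (2 * √r)) / √r ^ 2 : ℝ) : ℂ)) (v := g)
    (v' := fun r => Complex.exp (-(Complex.I * (b * r : ℝ))))
    (fun r hr => (hasDerivAt_inv_sqrt (hr₀.trans_le (hpos r hr))).ofReal_comp)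
    (fun r _ => hg r)
    (ContinuousOn.intervalIntegrable (by
      refine Complex.continuous_ofReal.comp_continuousOn ?_
      have : ∀ r ∈ uIcc l (l + ℓ), √r ≠ 0 := fun r hr =>
        (Real.sqrt_pos.2 (hr₀.trans_le (hpos r hr))).ne'
      refine ContinuousOn.div (ContinuousOn.neg (ContinuousOn.div (by fun_prop) (by fun_prop)
        fun r hr => by simp [this r hr])) (by fun_prop) fun r hr => by simp [this r hr]))
    (Continuous.intervalIntegrable (by fun_prop) _ _)
  rw [hparts]
  have hW : ∀ r, r₀ ≤ r → ‖(((√r)⁻¹ : ℝ) : ℂ)‖ ≤ (√r₀)⁻¹ := fun r hr => by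
    rw [Complex.norm_real, Real.norm_eq_abs, abs_of_nonneg (by positivity)]
    exact inv_anti₀ hs₀ (Real.sqrt_le_sqrt hr)
  have hb1 : ∀ r, r₀ ≤ r → ‖(((√r)⁻¹ : ℝ) : ℂ) * g r‖ ≤ (√r₀)⁻¹ / |b| := fun r hr => by
    rw [norm_mul, hgn, mul_one_div]
    gcongr
    exact hW r hr
  have hint : ‖∫ r in l..l + ℓ, ((-(1 / (2 * √r)) / √r ^ 2 : ℝ) : ℂ) * g r‖ ≤
      1 / (2 * √r₀) / √r₀ ^ 2 / |b| * |l + ℓ - l| := by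
    refine intervalIntegral.norm_integral_le_of_norm_le_const fun r hr => ?_
    have hr' : r₀ ≤ r := hpos r (uIoc_subset_uIcc hr)
    rw [norm_mul, hgn, mul_one_div, Complex.norm_real, Real.norm_eq_abs, abs_div, abs_neg,
      abs_of_nonneg (by positivity), abs_of_nonneg (by positivity)]
    gcongr
  rw [add_sub_cancel_left, abs_of_nonneg hℓ] at hint
  refine (norm_sub_le _ _).trans ((add_le_add (norm_sub_le _ _) hint).trans ?_)
  have := hb1 l hl
  have := hb1 (l + ℓ) (by linarith)
  calc _ ≤ (√r₀)⁻¹ / |b| + (√r₀)⁻¹ / |b| + 1 / (2 * √r₀) / √r₀ ^ 2 / |b| * ℓ := by gcongr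
    _ = _ := by ring

lemma continuousOn_hankelH0 : ContinuousOn hankelH0 (Ioi 0) := fun _ ht =>
  (hasDerivAt_hankelH0 ht).continuousAt.continuousWithinAt

/-- Integrals of `H₀(kr)` against a suitable one of the plane waves `e^{±ikr}` over intervals of
fixed length away from the origin have exact order `k^{-1/2}`. -/
lemma exists_hankelH0_integral_bounds {r₀ r₁ ℓ : ℝ} (hr₀ : 0 < r₀) (hr₁ : r₀ ≤ r₁) (hℓ : 0 < ℓ) :
    ∃ (s : ℝ) (ζ : ℂ) (c C k₀ : ℝ), |s| = 1 ∧ ‖ζ‖ = 1 ∧ 0 < c ∧ 0 < C ∧ 0 < k₀ ∧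
      ∀ k, k₀ ≤ k → ∀ l ∈ Icc r₀ r₁,
        c / √k ≤ (ζ * ∫ r in l..l + ℓ,
          hankelH0 (k * r) * Complex.exp (-(Complex.I * (s * k * r : ℝ)))).re ∧
        ‖∫ r in l..l + ℓ, hankelH0 (k * r) * Complex.exp (-(Complex.I * (s * k * r : ℝ)))‖
          ≤ C / √k := by
  obtain ⟨s, D, D', hs, hD, hlim⟩ := exists_hankelH0_modulated
  have hs₀ : 0 < √r₀ := Real.sqrt_pos.2 hr₀
  set R : ℝ → ℂ := fun t => (√t : ℂ) * hankelH0 t * Complex.exp (-(Complex.I * (s * t)))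
      - D - D' * Complex.exp (-(Complex.I * (2 * s * t))) with hR
  -- The main term is `D ∫ r^{-1/2}`, and `m` bounds this integral below for every admissible `l`.
  -- Both `ε` and `k₀` are chosen so that the remainder and the oscillating term each cost at most
  -- `‖D‖ m / 4`, half of the main term in all.
  set m : ℝ := ℓ * (√(r₁ + ℓ))⁻¹ with hm
  have hm0 : 0 < m := by
    have : 0 < √(r₁ + ℓ) := Real.sqrt_pos.2 (by linarith)
    positivity
  have hDn : 0 < ‖D‖ := norm_pos_iff.2 hD
  set ε : ℝ := ‖D‖ * m / 4 / (ℓ * (√r₀)⁻¹) with hε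
  have hε0 : 0 < ε := by positivity
  obtain ⟨T, hT⟩ := (Metric.tendsto_atTop.1 hlim) ε hε0
  set Q : ℝ := 2 * (√r₀)⁻¹ + ℓ * (1 / (2 * √r₀) / √r₀ ^ 2) with hQ
  have hQ0 : 0 < Q := by positivity
  set k₀ : ℝ := max 1 (max (T / r₀) (‖D'‖ * Q / (‖D‖ * m / 4))) with hk₀
  set P : ℝ → ℝ := fun l => ∫ r in l..l + ℓ, (√r)⁻¹ with hP
  have hPbd : ∀ l ∈ Icc r₀ r₁, m ≤ P l ∧ P l ≤ ℓ * (√r₀)⁻¹ := fun l hl => by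
    have hpos : ∀ r ∈ Icc l (l + ℓ), 0 < √r := fun r hr =>
      Real.sqrt_pos.2 (hr₀.trans_le (hl.1.trans hr.1))
    have hci : IntervalIntegrable (fun r => (√r)⁻¹) volume l (l + ℓ) := by
      refine ContinuousOn.intervalIntegrable ?_
      rw [uIcc_of_le (by linarith)]
      exact ContinuousOn.inv₀ (by fun_prop) fun r hr => (hpos r hr).ne'
    constructor
    · have := intervalIntegral.integral_mono_on (a := l) (b := l + ℓ)
        (f := fun _ => (√(r₁ + ℓ))⁻¹) (g := fun r => (√r)⁻¹) (by linarith) (by simp) hci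
        fun r hr => inv_anti₀ (hpos r hr) (Real.sqrt_le_sqrt (by linarith [hr.2, hl.2]))
      simpa [hm] using this
    · have := intervalIntegral.integral_mono_on (a := l) (b := l + ℓ)
        (g := fun _ => (√r₀)⁻¹) (f := fun r => (√r)⁻¹) (by linarith) hci (by simp)
        fun r hr => inv_anti₀ hs₀ (Real.sqrt_le_sqrt (hl.1.trans hr.1))
      simpa using this
  have key : ∀ k, k₀ ≤ k → ∀ l ∈ Icc r₀ r₁, ‖(√k : ℂ) * (∫ r in l..l + ℓ,
      hankelH0 (k * r) * Complex.exp (-(Complex.I * (s * k * r : ℝ)))) - D * P l‖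
        ≤ ‖D‖ * m / 2 := by
    intro k hk l hl
    have hk1 : 0 < k := one_pos.trans_le ((le_max_left _ _).trans hk)
    have hkT : T / r₀ ≤ k := ((le_max_left _ _).trans (le_max_right _ _)).trans hk
    have hkQ : ‖D'‖ * Q / (‖D‖ * m / 4) ≤ k :=
      ((le_max_right _ _).trans (le_max_right _ _)).trans hk
    have hpos : ∀ r ∈ uIcc l (l + ℓ), 0 < r := fun r hr => by
      rw [uIcc_of_le (by linarith)] at hr
      exact hr₀.trans_le (hl.1.trans hr.1)
    have hWc : ContinuousOn (fun r : ℝ => (((√r)⁻¹ : ℝ) : ℂ)) (uIcc l (l + ℓ)) :=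
      Complex.continuous_ofReal.comp_continuousOn
        (ContinuousOn.inv₀ (by fun_prop) fun r hr => (Real.sqrt_pos.2 (hpos r hr)).ne')
    have hHc : ContinuousOn (fun r : ℝ => hankelH0 (k * r)) (uIcc l (l + ℓ)) :=
      continuousOn_hankelH0.comp (by fun_prop) fun r hr => mul_pos hk1 (hpos r hr)
    have hRc : ContinuousOn (fun r : ℝ => R (k * r)) (uIcc l (l + ℓ)) := by
      simp only [hR]
      fun_prop
    have hpt : ∀ r ∈ uIcc l (l + ℓ), (√k : ℂ) *
        (hankelH0 (k * r) * Complex.exp (-(Complex.I * (s * k * r : ℝ)))) =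
        D * (((√r)⁻¹ : ℝ) : ℂ) + D' * ((((√r)⁻¹ : ℝ) : ℂ) *
          Complex.exp (-(Complex.I * (2 * s * k * r : ℝ)))) + (((√r)⁻¹ : ℝ) : ℂ) * R (k * r) := by
      intro r hr
      have hr0 : (√r : ℂ) ≠ 0 := by exact_mod_cast (Real.sqrt_pos.2 (hpos r hr)).ne'
      simp only [hR, Real.sqrt_mul hk1.le]
      push_cast
      have e1 : (s : ℂ) * (k * r) = s * k * r := by ring
      have e2 : 2 * (s : ℂ) * (k * r) = 2 * s * k * r := by ring
      rw [e1, e2]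
      field_simp
      ring
    have hI1 : IntervalIntegrable (fun r : ℝ => D * (((√r)⁻¹ : ℝ) : ℂ)) volume l (l + ℓ) :=
      (continuousOn_const.mul hWc).intervalIntegrable
    have hI2 : IntervalIntegrable (fun r : ℝ => D' * ((((√r)⁻¹ : ℝ) : ℂ) *
        Complex.exp (-(Complex.I * (2 * s * k * r : ℝ))))) volume l (l + ℓ) :=
      (continuousOn_const.mul (hWc.mul (by fun_prop))).intervalIntegrable
    have hI3 : IntervalIntegrable (fun r : ℝ => (((√r)⁻¹ : ℝ) : ℂ) * R (k * r)) volume l (l + ℓ) :=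
      (hWc.mul hRc).intervalIntegrable
    rw [← intervalIntegral.integral_const_mul, intervalIntegral.integral_congr hpt,
      intervalIntegral.integral_add (hI1.add hI2) hI3, intervalIntegral.integral_add hI1 hI2,
      intervalIntegral.integral_const_mul, intervalIntegral.integral_const_mul,
      intervalIntegral.integral_ofReal]
    have hosc := norm_integral_inv_sqrt_mul_exp_le (b := 2 * s * k) hr₀ hl.1 hℓ.le (by
      have : s ≠ 0 := fun h => by simp [h] at hs
      positivity)
    have habs : |2 * s * k| = 2 * k := by rw [abs_mul, abs_mul, hs, abs_of_pos hk1]; simp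
    rw [habs] at hosc
    have hrem : ‖∫ r in l..l + ℓ, (((√r)⁻¹ : ℝ) : ℂ) * R (k * r)‖ ≤
        (√r₀)⁻¹ * ε * |l + ℓ - l| := by
      refine intervalIntegral.norm_integral_le_of_norm_le_const fun r hr => ?_
      rw [uIoc_of_le (by linarith)] at hr
      have hr' : r₀ ≤ r := hl.1.trans hr.1.le
      rw [norm_mul, Complex.norm_real, Real.norm_eq_abs, abs_of_nonneg (by positivity)]
      have h1 : ‖R (k * r)‖ ≤ ε := by
        have := hT (k * r) (by
          rw [div_le_iff₀ hr₀] at hkT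
          exact hkT.trans (by gcongr))
        rw [dist_zero_right] at this
        exact this.le
      gcongr
    rw [add_sub_cancel_left, abs_of_pos hℓ] at hrem
    have e : (D * ((∫ r in l..l + ℓ, (√r)⁻¹ : ℝ) : ℂ) + D' * (∫ r in l..l + ℓ,
        (((√r)⁻¹ : ℝ) : ℂ) * Complex.exp (-(Complex.I * (2 * s * k * r : ℝ)))) +
        ∫ r in l..l + ℓ, (((√r)⁻¹ : ℝ) : ℂ) * R (k * r)) - D * (P l : ℂ) =
        D' * (∫ r in l..l + ℓ,
        (((√r)⁻¹ : ℝ) : ℂ) * Complex.exp (-(Complex.I * (2 * s * k * r : ℝ)))) +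
        ∫ r in l..l + ℓ, (((√r)⁻¹ : ℝ) : ℂ) * R (k * r) := by
      simp only [hP]; ring
    rw [e]
    refine (norm_add_le _ _).trans ?_
    rw [norm_mul]
    have hD1 : ‖D'‖ * (Q / (2 * k)) ≤ ‖D‖ * m / 4 := by
      rw [div_le_iff₀ (by positivity)] at hkQ
      rw [← mul_div_assoc, div_le_iff₀ (by positivity)]
      nlinarith [mul_pos hk1 (mul_pos hDn hm0)]
    have hD2 : (√r₀)⁻¹ * ε * ℓ = ‖D‖ * m / 4 := by
      rw [hε]; field_simp
    calc _ ≤ ‖D'‖ * (Q / (2 * k)) + (√r₀)⁻¹ * ε * ℓ := by gcongr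
      _ ≤ _ := by linarith
  -- The unimodular factor `conj D / ‖D‖` rotates the main term onto the positive real axis.
  refine ⟨s, (starRingEnd ℂ) D / ‖D‖, ‖D‖ * m / 2, ‖D‖ * (ℓ * (√r₀)⁻¹) + ‖D‖ * m / 2, k₀, hs,
    ?_, by positivity, by positivity, by positivity, fun k hk l hl => ?_⟩
  · rw [norm_div, RCLike.norm_conj, Complex.norm_real, norm_norm, div_self hDn.ne']
  have hk1 : 0 < k := one_pos.trans_le ((le_max_left _ _).trans hk)
  have hsk : 0 < √k := Real.sqrt_pos.2 hk1
  have hK := key k hk l hl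
  obtain ⟨hP1, hP2⟩ := hPbd l hl
  set J := ∫ r in l..l + ℓ, hankelH0 (k * r) * Complex.exp (-(Complex.I * (s * k * r : ℝ)))
  constructor
  · rw [div_le_iff₀ hsk]
    have h1 : ((starRingEnd ℂ) D / ‖D‖ * J).re * √k
        = ((starRingEnd ℂ) D / ‖D‖ * ((√k : ℂ) * J - D * P l)).re + ‖D‖ * P l := by
      have hDc : (‖D‖ : ℂ) ≠ 0 := by exact_mod_cast hDn.ne'
      have : (starRingEnd ℂ) D / ‖D‖ * J * √k
        = (starRingEnd ℂ) D / ‖D‖ * ((√k : ℂ) * J - D * P l) + (‖D‖ * P l : ℝ) := by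
        have hc := Complex.conj_mul' D
        push_cast
        field_simp
        linear_combination (P l : ℂ) * hc
      have h2 := congrArg Complex.re this
      rwa [Complex.re_mul_ofReal, Complex.add_re, Complex.ofReal_re] at h2
    rw [h1]
    have h2 := (abs_le.1 (Complex.abs_re_le_norm
      ((starRingEnd ℂ) D / ‖D‖ * ((√k : ℂ) * J - D * P l)))).1
    rw [norm_mul, norm_div, RCLike.norm_conj, Complex.norm_real, norm_norm, div_self hDn.ne',
      one_mul] at h2
    nlinarith
  · rw [le_div_iff₀ hsk]
    have h1 : ‖J‖ * √k = ‖(√k : ℂ) * J‖ := by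
      rw [norm_mul, Complex.norm_real, Real.norm_eq_abs, abs_of_pos hsk, mul_comm]
    have h2 : ‖D * (P l : ℂ)‖ ≤ ‖D‖ * (ℓ * (√r₀)⁻¹) := by
      rw [norm_mul, Complex.norm_real, Real.norm_eq_abs, abs_of_nonneg (hm0.le.trans hP1)]
      gcongr
    rw [h1]
    calc ‖(√k : ℂ) * J‖ = ‖D * (P l : ℂ) + ((√k : ℂ) * J - D * P l)‖ := by congr 1; ring
      _ ≤ _ := (norm_add_le _ _).trans (add_le_add h2 hK)

/-! ### Surface gradients and tangential derivatives -/

/-- The projection onto the tangent span fixes `τ`, so the directional derivative is the inner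
product of `τ` with the surface gradient; Cauchy–Schwarz finishes. -/
lemma norm_fderiv_apply_le_surfaceGradient {d : ℕ} {Ω : Set (Space d)} (u : Space d → ℂ)
    {x τ : Space d} (hτ : τ ∈ tangentSpan Ω x) :
    ‖fderiv ℝ u x τ‖ ≤ ‖τ‖ * ‖surfaceGradient Ω u x‖ := by
  have h1 : τ = ∑ j, τ j • EuclideanSpace.single j (1 : ℝ) := by
    have := (EuclideanSpace.basisFun (Fin d) ℝ).sum_repr τ
    simpa using this.symm
  have h2 : fderiv ℝ u x τ = inner ℂ (WithLp.toLp 2 fun j => (τ j : ℂ) : EuclideanSpace ℂ (Fin d))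
      (surfaceGradient Ω u x) := by
    conv_lhs => rw [← Submodule.starProjection_eq_self_iff.2 hτ, h1]
    simp only [map_sum, map_smul, PiLp.inner_apply, surfaceGradient, Complex.real_smul]
    refine Finset.sum_congr rfl fun j _ => ?_
    simp [mul_comm]
  have h3 : ‖(WithLp.toLp 2 fun j => (τ j : ℂ) : EuclideanSpace ℂ (Fin d))‖ = ‖τ‖ := by
    simp [EuclideanSpace.norm_eq]
  rw [h2, ← h3]
  exact norm_inner_le_norm _ _

/-! ### Integration by parts along boundary strips -/

/-- A set `S ⊆ ∂Ω` containing the image of the strip `[α, β] × W` under a map `X` for which the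
curves `t ↦ X (t, w)` are tangent to the vector field `τ` and progress in the direction `e`; the
product of Lebesgue measure and `ν` on the strip is controlled by surface measure. -/
structure IsBoundaryStrip {d : ℕ} (Ω : Set (Space d)) (e : Space d) (α β : ℝ) (W : Set ℝ)
    (ν : Measure ℝ) (K : ℝ≥0) (S : Set (Space d)) (X : ℝ × ℝ → Space d) (τ : Space d → Space d) :
    Prop where
  lt : α < β
  measurableSet_param : MeasurableSet W
  measure_ne_top : ν W ≠ ⊤
  measurableSet : MeasurableSet S
  measurable_map : Measurable X
  measurable_field : Measurable τ
  map_le : Measure.map X ((volume.restrict (Icc α β)).prod (ν.restrict W)) ≤ K • surfaceMeasure Ω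
  mem : ∀ t ∈ Icc α β, ∀ w ∈ W, X (t, w) ∈ S
  hasDerivAt : ∀ t ∈ Icc α β, ∀ w ∈ W, HasDerivAt (fun t => X (t, w)) (τ (X (t, w))) t
  tangent : ∀ x ∈ S, τ x ∈ tangentSpan Ω x
  norm_le : ∀ x ∈ S, ‖τ x‖ ≤ 2
  inner_ge : ∀ x ∈ S, 1 / 2 ≤ ⟪e, τ x⟫

namespace IsBoundaryStrip

variable {d : ℕ} {Ω : Set (Space d)} {e : Space d} {α β : ℝ} {W : Set ℝ} {ν : Measure ℝ} {K : ℝ≥0}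
  {S : Set (Space d)} {X : ℝ × ℝ → Space d} {τ : Space d → Space d}

/-- The measure on the parameter strip. -/
abbrev paramMeasure (α β : ℝ) (W : Set ℝ) (ν : Measure ℝ) : Measure (ℝ × ℝ) :=
  (volume.restrict (Icc α β)).prod (ν.restrict W)

lemma isFiniteMeasure (hS : IsBoundaryStrip Ω e α β W ν K S X τ) :
    IsFiniteMeasure (ν.restrict W) :=
  ⟨by simpa using hS.measure_ne_top.lt_top⟩

lemma paramMeasure_univ (hS : IsBoundaryStrip Ω e α β W ν K S X τ) :
    paramMeasure α β W ν univ = ENNReal.ofReal ((β - α) * ν.real W) := by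
  have := hS.isFiniteMeasure
  rw [← univ_prod_univ, Measure.prod_prod, Measure.restrict_apply_univ, Measure.restrict_apply_univ,
    Real.volume_Icc, ENNReal.ofReal_mul (by linarith [hS.lt]), ofReal_measureReal hS.measure_ne_top]

lemma ae_mem_strip (hS : IsBoundaryStrip Ω e α β W ν K S X τ) :
    ∀ᵐ p ∂paramMeasure α β W ν, p.1 ∈ Icc α β ∧ p.2 ∈ W := by
  have := hS.isFiniteMeasure
  refine (Measure.ae_prod_iff_ae_ae
    (measurableSet_Icc.prod hS.measurableSet_param)).2 ?_
  filter_upwards [ae_restrict_mem measurableSet_Icc] with t ht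
  filter_upwards [ae_restrict_mem hS.measurableSet_param] with w hw
  exact ⟨ht, hw⟩

lemma ae_mem (hS : IsBoundaryStrip Ω e α β W ν K S X τ) :
    ∀ᵐ p ∂paramMeasure α β W ν, X p ∈ S :=
  hS.ae_mem_strip.mono fun p hp => hS.mem p.1 hp.1 p.2 hp.2

lemma aestronglyMeasurable_comp (hS : IsBoundaryStrip Ω e α β W ν K S X τ) {E : Type*}
    [TopologicalSpace E] {f : Space d → E} (hf : AEStronglyMeasurable f (surfaceMeasure Ω)) :
    AEStronglyMeasurable (fun p => f (X p)) (paramMeasure α β W ν) :=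
  ((hf.smul_measure K).mono_measure hS.map_le).comp_measurable hS.measurable_map

lemma eLpNorm_comp_le (hS : IsBoundaryStrip Ω e α β W ν K S X τ) {E : Type*}
    [NormedAddCommGroup E] {f : Space d → E} (hf : AEStronglyMeasurable f (surfaceMeasure Ω)) :
    eLpNorm (fun p => f (X p)) 2 (paramMeasure α β W ν) ≤
      ENNReal.ofReal √K * eLpNorm f 2 (surfaceMeasure Ω) := by
  have h1 := eLpNorm_map_measure (p := 2) ((hf.smul_measure K).mono_measure hS.map_le)
    hS.measurable_map.aemeasurable
  have h2 := eLpNorm_mono_measure (p := 2) f hS.map_le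
  rw [h1] at h2
  refine h2.trans_eq ?_
  rw [show K • surfaceMeasure Ω = (K : ℝ≥0∞) • surfaceMeasure Ω from rfl, eLpNorm_smul_measure_of_ne_top (by norm_num), smul_eq_mul]
  congr 1
  rw [Real.sqrt_eq_rpow, ← ENNReal.ofReal_rpow_of_nonneg (by positivity) (by norm_num),
    ENNReal.ofReal_coe_nnreal]
  norm_num

/-- Cauchy–Schwarz on the parameter strip, whose total mass is `(β - α) ν(W)`, followed by the
domination of measures. -/
lemma lintegral_comp_le (hS : IsBoundaryStrip Ω e α β W ν K S X τ) {E : Type*}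
    [NormedAddCommGroup E] {f : Space d → E} (hf : AEStronglyMeasurable f (surfaceMeasure Ω)) :
    ∫⁻ p, ‖f (X p)‖ₑ ∂paramMeasure α β W ν ≤
      ENNReal.ofReal √(K * ((β - α) * ν.real W)) * eLpNorm f 2 (surfaceMeasure Ω) := by
  have hL := hS.lt
  have h := eLpNorm_le_eLpNorm_mul_rpow_measure_univ (p := 1) (q := 2) (by norm_num)
    (hS.aestronglyMeasurable_comp hf)
  rw [eLpNorm_one_eq_lintegral_enorm, hS.paramMeasure_univ] at h
  refine h.trans ((mul_le_mul_left (hS.eLpNorm_comp_le hf) _).trans_eq ?_)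
  rw [ENNReal.ofReal_rpow_of_nonneg (by have := sub_pos.2 hL; positivity) (by norm_num),
    Real.sqrt_mul (by positivity), ENNReal.ofReal_mul (by positivity), Real.sqrt_eq_rpow (_ * _)]
  norm_num
  ring

/-- Bounds for a function on a strip give a lower bound for its `L²` norm. -/
lemma le_normL2 (hS : IsBoundaryStrip Ω e α β W ν K S X τ) {v : Space d → ℂ} {a : ℝ} (ha : 0 ≤ a)
    (hK : 0 < K) (hv : ∀ x ∈ S, a ≤ ‖v x‖) :
    ENNReal.ofReal (a * √((β - α) * ν.real W) / √K) ≤ normL2 Ω v := by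
  have h1 : eLpNorm (S.indicator fun _ => a) 2 (surfaceMeasure Ω) ≤ normL2 Ω v := by
    refine eLpNorm_mono fun x => ?_
    by_cases hx : x ∈ S
    · rw [indicator_of_mem hx, Real.norm_eq_abs, abs_of_nonneg ha]; exact hv x hx
    · rw [indicator_of_notMem hx]; simp
  refine le_trans ?_ h1
  have h2 := hS.eLpNorm_comp_le (f := S.indicator fun _ => a)
    (aestronglyMeasurable_const.indicator hS.measurableSet)
  have h3 : eLpNorm (fun p => S.indicator (fun _ => a) (X p)) 2 (paramMeasure α β W ν)
      = ENNReal.ofReal (a * √((β - α) * ν.real W)) := by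
    rw [eLpNorm_congr_ae (g := fun _ => a)
      (hS.ae_mem.mono fun p hp => indicator_of_mem hp _)]
    have := hS.lt
    by_cases h0 : paramMeasure α β W ν = 0
    · have h00 := hS.paramMeasure_univ
      rw [h0] at h00
      have h01 : (β - α) * ν.real W ≤ 0 := by
        rw [← ENNReal.ofReal_eq_zero]; simpa using h00.symm
      rw [h0, Real.sqrt_eq_zero_of_nonpos h01]; simp
    rw [eLpNorm_const _ (by norm_num) h0, hS.paramMeasure_univ, ENNReal.ofReal_mul ha,
      ENNReal.ofReal_rpow_of_nonneg (by have := sub_pos.2 this; positivity) (by norm_num),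
      Real.sqrt_eq_rpow, Real.enorm_eq_ofReal ha]
    norm_num
  rw [h3] at h2
  have hsK : 0 < √(K : ℝ) := Real.sqrt_pos.2 (by exact_mod_cast hK)
  rw [ENNReal.ofReal_div_of_pos hsK]
  exact ENNReal.div_le_of_le_mul' h2

/-- The plane wave `e^{-iκ e·x}`. -/
def planeWave (e : Space d) (κ : ℝ) (x : Space d) : ℂ :=
  Complex.exp (-(Complex.I * (κ * ⟪e, x⟫ : ℝ)))

lemma norm_planeWave (e : Space d) (κ : ℝ) (x : Space d) : ‖planeWave e κ x‖ = 1 :=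
  norm_exp_neg_I_mul_ofReal _

lemma continuous_planeWave (e : Space d) (κ : ℝ) : Continuous (planeWave e κ) := by
  unfold planeWave
  fun_prop

/-- The negative of the derivative of `t ↦ e^{-iκ e·x} (t - α) (β - t)` along a curve through `x`
with velocity `τ x`. -/
def testWeight (e : Space d) (τ : Space d → Space d) (α β κ : ℝ) (x : Space d) (t : ℝ) : ℂ :=
  planeWave e κ x * (Complex.I * (κ * ⟪e, τ x⟫ * ((t - α) * (β - t)) : ℝ) - (α + β - 2 * t : ℝ))

lemma measurable_testWeight (hS : IsBoundaryStrip Ω e α β W ν K S X τ) (κ : ℝ) :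
    Measurable fun p : ℝ × ℝ => testWeight e τ α β κ (X p) p.1 := by
  have h1 := (continuous_planeWave e κ).measurable.comp hS.measurable_map
  have h2 : Measurable fun p : ℝ × ℝ => ⟪e, τ (X p)⟫ :=
    (continuous_const.inner continuous_id).measurable.comp
      (hS.measurable_field.comp hS.measurable_map)
  refine h1.mul (Measurable.sub (Measurable.const_mul (Complex.measurable_ofReal.comp ?_) _)
    (Complex.measurable_ofReal.comp (by fun_prop)))
  fun_prop

lemma cutoff_mem {α β t : ℝ} (ht : t ∈ Icc α β) :
    0 ≤ (t - α) * (β - t) ∧ (t - α) * (β - t) ≤ (β - α) ^ 2 ∧ |α + β - 2 * t| ≤ β - α := by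
  obtain ⟨h1, h2⟩ := ht
  refine ⟨mul_nonneg (by linarith) (by linarith), ?_, abs_le.2 ⟨by linarith, by linarith⟩⟩
  nlinarith

lemma abs_inner_field_le (hS : IsBoundaryStrip Ω e α β W ν K S X τ) (he : ‖e‖ = 1) {x : Space d}
    (hx : x ∈ S) : |⟪e, τ x⟫| ≤ 2 :=
  (abs_real_inner_le_norm _ _).trans (by rw [he, one_mul]; exact hS.norm_le x hx)

lemma norm_testWeight_le (hS : IsBoundaryStrip Ω e α β W ν K S X τ) (he : ‖e‖ = 1) (κ : ℝ)
    {x : Space d} (hx : x ∈ S) {t : ℝ} (ht : t ∈ Icc α β) :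
    ‖testWeight e τ α β κ x t‖ ≤ |κ| * 2 * (β - α) ^ 2 + (β - α) := by
  obtain ⟨h0, h1, h2⟩ := cutoff_mem ht
  rw [testWeight, norm_mul, norm_planeWave, one_mul]
  refine (norm_sub_le _ _).trans ?_
  rw [norm_mul, Complex.norm_I, one_mul, Complex.norm_real, Complex.norm_real, Real.norm_eq_abs,
    Real.norm_eq_abs, abs_mul, abs_mul, abs_of_nonneg h0]
  have := hS.abs_inner_field_le he hx
  gcongr

lemma measurable_fderiv_field (hS : IsBoundaryStrip Ω e α β W ν K S X τ) {u : Space d → ℂ}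
    (hu : ContDiff ℝ ∞ u) : Measurable fun x => fderiv ℝ u x (τ x) := by
  have h1 : Continuous fun q : Space d × Space d => fderiv ℝ u q.1 q.2 :=
    ((hu.continuous_fderiv (by simp)).comp continuous_fst).clm_apply continuous_snd
  exact h1.measurable.comp (measurable_id.prodMk hS.measurable_field)

lemma ae_norm_le_of_mem (hS : IsBoundaryStrip Ω e α β W ν K S X τ) {F : ℝ × ℝ → ℂ} {C : ℝ}
    (h : ∀ t ∈ Icc α β, ∀ w ∈ W, ‖F (t, w)‖ ≤ C) : ∀ᵐ p ∂paramMeasure α β W ν, ‖F p‖ ≤ C :=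
  hS.ae_mem_strip.mono fun p hp => h p.1 hp.1 p.2 hp.2

/-- Integration by parts along the strip. -/
lemma integral_mul_testWeight (hS : IsBoundaryStrip Ω e α β W ν K S X τ) (he : ‖e‖ = 1) (κ : ℝ)
    {u : Space d → ℂ} (hu : ContDiff ℝ ∞ u) (hcu : HasCompactSupport u) :
    ∫ p, u (X p) * testWeight e τ α β κ (X p) p.1 ∂paramMeasure α β W ν =
      ∫ p, fderiv ℝ u (X p) (τ (X p)) * (planeWave e κ (X p) * ((p.1 - α) * (β - p.1) : ℝ))
        ∂paramMeasure α β W ν := by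
  have hfin := hS.isFiniteMeasure
  obtain ⟨C₀, hC₀⟩ := hcu.exists_bound_of_continuous hu.continuous
  obtain ⟨C₁, hC₁⟩ := (hcu.fderiv ℝ).exists_bound_of_continuous (hu.continuous_fderiv (by simp))
  have hm1 : Measurable fun p : ℝ × ℝ => u (X p) * testWeight e τ α β κ (X p) p.1 :=
    (hu.continuous.measurable.comp hS.measurable_map).mul (hS.measurable_testWeight κ)
  have hm2 : Measurable fun p : ℝ × ℝ =>
      fderiv ℝ u (X p) (τ (X p)) * (planeWave e κ (X p) * ((p.1 - α) * (β - p.1) : ℝ)) :=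
    ((hS.measurable_fderiv_field hu).comp hS.measurable_map).mul
      (((continuous_planeWave e κ).measurable.comp hS.measurable_map).mul
        (Complex.measurable_ofReal.comp (by fun_prop)))
  have hb1 : ∀ t ∈ Icc α β, ∀ w ∈ W, ‖u (X (t, w)) * testWeight e τ α β κ (X (t, w)) t‖ ≤
      C₀ * (|κ| * 2 * (β - α) ^ 2 + (β - α)) := fun t ht w hw => by
    rw [norm_mul]
    have hC := (norm_nonneg _).trans (hC₀ (X (t, w)))
    gcongr
    · exact hC₀ _
    · exact hS.norm_testWeight_le he κ (hS.mem t ht w hw) ht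
  have hb2 : ∀ t ∈ Icc α β, ∀ w ∈ W, ‖fderiv ℝ u (X (t, w)) (τ (X (t, w))) *
      (planeWave e κ (X (t, w)) * ((t - α) * (β - t) : ℝ))‖ ≤ C₁ * 2 * (β - α) ^ 2 :=
    fun t ht w hw => by
    obtain ⟨h0, h1, -⟩ := cutoff_mem ht
    rw [norm_mul, norm_mul, norm_planeWave, one_mul, Complex.norm_real, Real.norm_eq_abs,
      abs_of_nonneg h0]
    have hC := (norm_nonneg _).trans (hC₁ (X (t, w)))
    gcongr
    refine (ContinuousLinearMap.le_opNorm _ _).trans ?_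
    gcongr
    · exact hC₁ _
    · exact hS.norm_le _ (hS.mem t ht w hw)
  have hI1 : Integrable (fun p : ℝ × ℝ => u (X p) * testWeight e τ α β κ (X p) p.1)
      (paramMeasure α β W ν) := Integrable.of_bound hm1.aestronglyMeasurable _
    (hS.ae_norm_le_of_mem hb1)
  have hI2 : Integrable (fun p : ℝ × ℝ => fderiv ℝ u (X p) (τ (X p)) *
      (planeWave e κ (X p) * ((p.1 - α) * (β - p.1) : ℝ))) (paramMeasure α β W ν) :=
    Integrable.of_bound hm2.aestronglyMeasurable _ (hS.ae_norm_le_of_mem hb2)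
  rw [← sub_eq_zero, ← integral_sub hI1 hI2]
  -- Integrating in `t` first, the inner integrand is an exact derivative of a product containing
  -- the cutoff `(t - α)(β - t)`, which vanishes at both ends.
  refine (integral_prod_symm _ (hI1.sub hI2)).trans ?_
  refine integral_eq_zero_of_ae ?_
  filter_upwards [ae_restrict_mem hS.measurableSet_param] with w hw
  simp only [Pi.zero_apply, Pi.sub_apply]
  rw [integral_Icc_eq_integral_Ioc, ← intervalIntegral.integral_of_le hS.lt.le]
  have hder : ∀ t ∈ uIcc α β, HasDerivAt
      (fun t => -(u (X (t, w)) * (planeWave e κ (X (t, w)) * ((t - α) * (β - t) : ℝ))))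
      (u (X (t, w)) * testWeight e τ α β κ (X (t, w)) t - fderiv ℝ u (X (t, w)) (τ (X (t, w))) *
      (planeWave e κ (X (t, w)) * ((t - α) * (β - t) : ℝ))) t := by
    intro t ht
    rw [uIcc_of_le hS.lt.le] at ht
    have hX := hS.hasDerivAt t ht w hw
    have h1 : HasDerivAt (fun t => u (X (t, w))) (fderiv ℝ u (X (t, w)) (τ (X (t, w)))) t :=
      ((hu.differentiable (by simp)).differentiableAt.hasFDerivAt).comp_hasDerivAt t hX
    have h2 : HasDerivAt (fun t => planeWave e κ (X (t, w)))
        (planeWave e κ (X (t, w)) * -(Complex.I * (κ * ⟪e, τ (X (t, w))⟫ : ℝ))) t := by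
      have h3 : HasDerivAt (fun t => ⟪e, X (t, w)⟫) ⟪e, τ (X (t, w))⟫ t := by
        have := (hasDerivAt_const t e).inner ℝ hX
        simpa using this
      exact (((h3.const_mul κ).ofReal_comp.const_mul Complex.I).neg).cexp
    have h3 : HasDerivAt (fun t : ℝ => (t - α) * (β - t)) (α + β - 2 * t) t := by
      refine (((hasDerivAt_id t).sub_const α).mul ((hasDerivAt_id t).const_sub β)).congr_deriv ?_
      simp only [id]; ring
    refine (h1.mul (h2.mul h3.ofReal_comp)).neg.congr_deriv ?_
    simp only [testWeight, Pi.mul_apply]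
    push_cast
    ring
  rw [intervalIntegral.integral_eq_sub_of_hasDerivAt hder]
  · simp
  · rw [intervalIntegrable_iff_integrableOn_Ioc_of_le hS.lt.le]
    have hmw : Measurable fun t : ℝ => (t, w) := by fun_prop
    refine Integrable.of_bound ((hm1.comp hmw).sub (hm2.comp hmw)).aestronglyMeasurable
      (C₀ * (|κ| * 2 * (β - α) ^ 2 + (β - α)) + C₁ * 2 * (β - α) ^ 2) ?_
    filter_upwards [ae_restrict_mem measurableSet_Ioc] with t ht
    have ht' := Ioc_subset_Icc_self ht
    exact (norm_sub_le _ _).trans (add_le_add (hb1 t ht' w hw) (hb2 t ht' w hw))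

/-- The tangential derivative of a smooth function along the strip is controlled by any field `g`
up to the distance of `g` to its surface gradient. -/
lemma enorm_integral_mul_testWeight_le (hS : IsBoundaryStrip Ω e α β W ν K S X τ) (he : ‖e‖ = 1)
    (κ : ℝ) {u : Space d → ℂ} (hu : ContDiff ℝ ∞ u) (hcu : HasCompactSupport u)
    {g : Space d → EuclideanSpace ℂ (Fin d)} (hg : AEStronglyMeasurable g (surfaceMeasure Ω)) :
    ‖∫ p, u (X p) * testWeight e τ α β κ (X p) p.1 ∂paramMeasure α β W ν‖ₑ ≤
      ENNReal.ofReal ((β - α) ^ 2) * (ENNReal.ofReal √(K * ((β - α) * ν.real W)) *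
        (2 * (eLpNorm (fun x => surfaceGradient Ω u x - g x) 2 (surfaceMeasure Ω) +
          eLpNorm g 2 (surfaceMeasure Ω)))) := by
  rw [hS.integral_mul_testWeight he κ hu hcu]
  set D : Space d → ℂ := S.indicator fun x => fderiv ℝ u x (τ x) with hD
  have hDm : Measurable D := (hS.measurable_fderiv_field hu).indicator hS.measurableSet
  have h1 : ‖∫ p, fderiv ℝ u (X p) (τ (X p)) *
      (planeWave e κ (X p) * ((p.1 - α) * (β - p.1) : ℝ)) ∂paramMeasure α β W ν‖ₑ ≤
      ENNReal.ofReal ((β - α) ^ 2) * ∫⁻ p, ‖D (X p)‖ₑ ∂paramMeasure α β W ν := by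
    refine (enorm_integral_le_lintegral_enorm _).trans ?_
    rw [← lintegral_const_mul' _ _ ENNReal.ofReal_ne_top]
    refine lintegral_mono_ae (hS.ae_mem_strip.mono fun p hp => ?_)
    obtain ⟨h0, h1, -⟩ := cutoff_mem hp.1
    have hx : X p ∈ S := hS.mem p.1 hp.1 p.2 hp.2
    rw [hD, indicator_of_mem hx, enorm_mul, mul_comm]
    gcongr
    rw [← ofReal_norm, norm_mul, norm_planeWave, one_mul, Complex.norm_real, Real.norm_eq_abs,
      abs_of_nonneg h0]
    exact ENNReal.ofReal_le_ofReal h1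
  refine h1.trans ?_
  gcongr
  refine (hS.lintegral_comp_le hDm.aestronglyMeasurable).trans ?_
  gcongr
  -- Minkowski's inequality needs measurable summands, and measurability of `surfaceGradient Ω u` is
  -- not established here. The measurable function `h` replaces the difference from `g`: it is
  -- pointwise at most twice that difference, and `‖D‖ ≤ h + 2‖g‖`.
  set h : Space d → ℝ := fun x => max (‖D x‖ - 2 * ‖g x‖) 0 with hh
  have hhm : AEStronglyMeasurable h (surfaceMeasure Ω) :=
    ((hDm.aestronglyMeasurable.norm).sub (hg.norm.const_mul 2)).sup aestronglyMeasurable_const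
  have hDle : ∀ x, ‖D x‖ ≤ 2 * ‖surfaceGradient Ω u x‖ := fun x => by
    by_cases hx : x ∈ S
    · rw [hD, indicator_of_mem hx]
      refine (norm_fderiv_apply_le_surfaceGradient u (hS.tangent x hx)).trans ?_
      gcongr
      exact hS.norm_le x hx
    · rw [hD, indicator_of_notMem hx]; simp
  have e1 : eLpNorm h 2 (surfaceMeasure Ω) ≤
      ENNReal.ofReal 2 * eLpNorm (fun x => surfaceGradient Ω u x - g x) 2 (surfaceMeasure Ω) := by
    refine eLpNorm_le_mul_eLpNorm_of_ae_le_mul (Eventually.of_forall fun x => ?_) _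
    rw [hh, Real.norm_eq_abs, abs_of_nonneg (le_max_right _ _)]
    refine max_le ?_ (by positivity)
    have := norm_sub_norm_le (surfaceGradient Ω u x) (g x)
    linarith [hDle x]
  have e2 : eLpNorm (fun x => 2 * ‖g x‖) 2 (surfaceMeasure Ω) ≤
      ENNReal.ofReal 2 * eLpNorm g 2 (surfaceMeasure Ω) := by
    refine eLpNorm_le_mul_eLpNorm_of_ae_le_mul (Eventually.of_forall fun x => ?_) _
    simp
  calc eLpNorm D 2 (surfaceMeasure Ω)
      ≤ eLpNorm (h + fun x => 2 * ‖g x‖) 2 (surfaceMeasure Ω) := by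
        refine eLpNorm_mono_ae (Eventually.of_forall fun x => ?_)
        rw [Pi.add_apply, Real.norm_eq_abs, abs_of_nonneg (by positivity)]
        have := le_max_left (‖D x‖ - 2 * ‖g x‖) 0
        simp only [hh]
        linarith
    _ ≤ _ := eLpNorm_add_le hhm (hg.norm.const_mul 2) (by norm_num)
    _ ≤ _ := by
      rw [mul_add]
      have : ENNReal.ofReal 2 = 2 := by simp
      rw [this] at e1 e2
      exact add_le_add e1 e2

/-- The estimate of `enorm_integral_mul_testWeight_le` for functions with a surface gradient. -/
lemma enorm_integral_mul_testWeight_le_of_hasSurfaceGradient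
    (hS : IsBoundaryStrip Ω e α β W ν K S X τ) (he : ‖e‖ = 1) (κ : ℝ) {v : Space d → ℂ}
    {g : Space d → EuclideanSpace ℂ (Fin d)} (hv : HasSurfaceGradient Ω v g) {b : ℝ}
    (hb : ∀ x ∈ S, ‖v x‖ ≤ b) :
    ‖∫ p, v (X p) * testWeight e τ α β κ (X p) p.1 ∂paramMeasure α β W ν‖ₑ ≤
      ENNReal.ofReal ((β - α) ^ 2) * (ENNReal.ofReal √(K * ((β - α) * ν.real W)) *
        (2 * eLpNorm g 2 (surfaceMeasure Ω))) := by
  have hfin := hS.isFiniteMeasure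
  obtain ⟨hv2, hg2, u, hu, hlim, hlimg⟩ := hv
  set B : ℝ := |κ| * 2 * (β - α) ^ 2 + (β - α)
  set c₁ := ENNReal.ofReal √(K * ((β - α) * ν.real W))
  have hB : ∀ᵐ p ∂paramMeasure α β W ν, ‖testWeight e τ α β κ (X p) p.1‖ ≤ B :=
    hS.ae_mem_strip.mono fun p hp => hS.norm_testWeight_le he κ (hS.mem p.1 hp.1 p.2 hp.2) hp.1
  have hwm := (hS.measurable_testWeight κ).aestronglyMeasurable (μ := paramMeasure α β W ν)
  have hvi : Integrable (fun p : ℝ × ℝ => v (X p) * testWeight e τ α β κ (X p) p.1)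
      (paramMeasure α β W ν) := by
    refine Integrable.of_bound ((hS.aestronglyMeasurable_comp hv2.1).mul hwm) (b * B) ?_
    filter_upwards [hB, hS.ae_mem] with p hp hx
    rw [norm_mul]
    have := (norm_nonneg _).trans (hb _ hx)
    gcongr
    exact hb _ hx
  have hui : ∀ n, Integrable (fun p : ℝ × ℝ => u n (X p) * testWeight e τ α β κ (X p) p.1)
      (paramMeasure α β W ν) := fun n => by
    obtain ⟨C₀, hC₀⟩ := (hu n).2.exists_bound_of_continuous (hu n).1.continuous
    refine Integrable.of_bound (((hu n).1.continuous.measurable.comp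
      hS.measurable_map).aestronglyMeasurable.mul hwm) (C₀ * B) ?_
    filter_upwards [hB] with p hp
    rw [norm_mul]
    have := (norm_nonneg _).trans (hC₀ (X p))
    gcongr
    exact hC₀ _
  -- Since the weight is bounded by `B`, replacing `v` by `u n` costs a multiple of their `L²`
  -- distance; this and the gradient error vanish in the limit.
  have key : ∀ n, ‖∫ p, v (X p) * testWeight e τ α β κ (X p) p.1 ∂paramMeasure α β W ν‖ₑ ≤
      ENNReal.ofReal B * (c₁ * eLpNorm (fun x => u n x - v x) 2 (surfaceMeasure Ω)) +
      ENNReal.ofReal ((β - α) ^ 2) * (c₁ *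
        (2 * (eLpNorm (fun x => surfaceGradient Ω (u n) x - g x) 2 (surfaceMeasure Ω) +
          eLpNorm g 2 (surfaceMeasure Ω)))) := fun n => by
    have h1 := hS.enorm_integral_mul_testWeight_le he κ (hu n).1 (hu n).2 hg2.1
    have h2 : ‖∫ p, (u n (X p) - v (X p)) * testWeight e τ α β κ (X p) p.1
        ∂paramMeasure α β W ν‖ₑ ≤
        ENNReal.ofReal B * (c₁ * eLpNorm (fun x => u n x - v x) 2 (surfaceMeasure Ω)) := by
      have hm : AEStronglyMeasurable (fun x => u n x - v x) (surfaceMeasure Ω) :=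
        (hu n).1.continuous.aestronglyMeasurable.sub hv2.1
      refine le_trans ?_ (mul_le_mul_right (hS.lintegral_comp_le hm) (ENNReal.ofReal B))
      refine (enorm_integral_le_lintegral_enorm _).trans ?_
      rw [← lintegral_const_mul' _ _ ENNReal.ofReal_ne_top]
      refine lintegral_mono_ae (hB.mono fun p hp => ?_)
      rw [enorm_mul, mul_comm]
      gcongr
      rw [← ofReal_norm]
      exact ENNReal.ofReal_le_ofReal hp
    have h3 : ∫ p, v (X p) * testWeight e τ α β κ (X p) p.1 ∂paramMeasure α β W ν =
        -(∫ p, (u n (X p) - v (X p)) * testWeight e τ α β κ (X p) p.1 ∂paramMeasure α β W ν) +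
        ∫ p, u n (X p) * testWeight e τ α β κ (X p) p.1 ∂paramMeasure α β W ν := by
      simp only [sub_mul]
      rw [integral_sub (hui n) hvi]
      ring
    rw [h3]
    refine (enorm_add_le _ _).trans (add_le_add ?_ h1)
    rw [enorm_neg]
    exact h2
  have t1 : Tendsto (fun n => ENNReal.ofReal B * (c₁ *
      eLpNorm (fun x => u n x - v x) 2 (surfaceMeasure Ω))) atTop (𝓝 (ENNReal.ofReal B * (c₁ * 0))) :=
    ENNReal.Tendsto.const_mul (ENNReal.Tendsto.const_mul hlim (Or.inr ENNReal.ofReal_ne_top))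
      (Or.inr ENNReal.ofReal_ne_top)
  have t2 : Tendsto (fun n => ENNReal.ofReal ((β - α) ^ 2) * (c₁ *
        (2 * (eLpNorm (fun x => surfaceGradient Ω (u n) x - g x) 2 (surfaceMeasure Ω) +
          eLpNorm g 2 (surfaceMeasure Ω))))) atTop (𝓝 (ENNReal.ofReal ((β - α) ^ 2) * (c₁ *
        (2 * (0 + eLpNorm g 2 (surfaceMeasure Ω)))))) :=
    ENNReal.Tendsto.const_mul (ENNReal.Tendsto.const_mul (ENNReal.Tendsto.const_mul
      (hlimg.add tendsto_const_nhds) (Or.inr (by norm_num))) (Or.inr ENNReal.ofReal_ne_top))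
      (Or.inr ENNReal.ofReal_ne_top)
  refine (ge_of_tendsto' (t1.add t2) key).trans_eq ?_
  simp

lemma setIntegral_cutoff (h : α ≤ β) :
    ∫ t in Icc α β, (t - α) * (β - t) = (β - α) ^ 3 / 6 := by
  rw [integral_Icc_eq_integral_Ioc, ← intervalIntegral.integral_of_le h]
  have hd : ∀ t ∈ uIcc α β, HasDerivAt
      (fun t => (t - α) ^ 2 / 2 * (β - α) - (t - α) ^ 3 / 3) ((t - α) * (β - t)) t := fun t _ => by
    have h1 := (hasDerivAt_id t).sub_const α
    refine ((((h1.pow 2).div_const 2).mul_const (β - α)).sub ((h1.pow 3).div_const 3)).congr_deriv ?_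
    simp only [id]
    push_cast
    ring
  rw [intervalIntegral.integral_eq_sub_of_hasDerivAt hd
    (Continuous.intervalIntegrable (by fun_prop) _ _)]
  ring

/-- In `testWeight` the derivative of the plane wave gives a term proportional to `κ ⟪e, τ⟫`. Since
`⟪e, τ⟫ ≥ 1/2`, after rotation its contribution is at least `a|κ|/2` times the cutoff, whose
integral is `(β - α)³/6`. The derivative of the cutoff contributes the error `b(β - α)` pointwise.
-/
lemma le_norm_integral_mul_testWeight (hS : IsBoundaryStrip Ω e α β W ν K S X τ) (he : ‖e‖ = 1)
    {v : Space d → ℂ} (hvm : AEStronglyMeasurable v (surfaceMeasure Ω)) {κ a b : ℝ} {ζ : ℂ}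
    (hζ : ‖ζ‖ = 1) (ha : 0 ≤ a) (hva : ∀ x ∈ S, a ≤ (ζ * (v x * planeWave e κ x)).re)
    (hvb : ∀ x ∈ S, ‖v x‖ ≤ b) :
    ν.real W * (a * |κ| * (β - α) ^ 3 / 12 - b * (β - α) ^ 2) ≤
      ‖∫ p, v (X p) * testWeight e τ α β κ (X p) p.1 ∂paramMeasure α β W ν‖ := by
  have hfin := hS.isFiniteMeasure
  set F : ℝ × ℝ → ℂ := fun p => v (X p) * testWeight e τ α β κ (X p) p.1 with hF
  obtain ⟨s, hs, hsκ⟩ : ∃ s : ℝ, |s| = 1 ∧ s * κ = |κ| := by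
    rcases le_total 0 κ with h | h
    · exact ⟨1, by simp, by rw [abs_of_nonneg h, one_mul]⟩
    · exact ⟨-1, by simp, by rw [abs_of_nonpos h]; ring⟩
  have hFi : Integrable F (paramMeasure α β W ν) := by
    refine Integrable.of_bound ((hS.aestronglyMeasurable_comp hvm).mul
      (hS.measurable_testWeight κ).aestronglyMeasurable)
      (b * (|κ| * 2 * (β - α) ^ 2 + (β - α))) (hS.ae_mem_strip.mono fun p hp => ?_)
    have hx := hS.mem p.1 hp.1 p.2 hp.2
    rw [norm_mul]
    have := (norm_nonneg _).trans (hvb _ hx)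
    gcongr
    · exact hvb _ hx
    · exact hS.norm_testWeight_le he κ hx hp.1
  -- Here `-i` cancels the `i` brought down by differentiation, `s` the sign of `κ`, and `ζ` the
  -- phase of `v e^{-iκ e·x}`.
  set η : ℂ := -Complex.I * s * ζ with hη
  have hηn : ‖η‖ = 1 := by
    rw [hη, norm_mul, norm_mul, norm_neg, Complex.norm_I, Complex.norm_real, Real.norm_eq_abs, hs,
      hζ]; norm_num
  have hlow : ∀ᵐ p ∂paramMeasure α β W ν,
      a * |κ| / 2 * ((p.1 - α) * (β - p.1)) - b * (β - α) ≤ (η * F p).re := by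
    refine hS.ae_mem_strip.mono fun p hp => ?_
    have hx := hS.mem p.1 hp.1 p.2 hp.2
    obtain ⟨h0, -, h2⟩ := cutoff_mem hp.1
    have e1 : η * F p = ζ * (v (X p) * planeWave e κ (X p)) *
        ((|κ| * ⟪e, τ (X p)⟫ * ((p.1 - α) * (β - p.1)) : ℝ) : ℂ) +
        (Complex.I * s * ζ * (v (X p) * planeWave e κ (X p))) * ((α + β - 2 * p.1 : ℝ) : ℂ) := by
      rw [← hsκ]
      simp only [hη, hF, testWeight]
      push_cast
      linear_combination (-(s : ℂ) * ζ * v (X p) * planeWave e κ (X p) * κ * ⟪e, τ (X p)⟫ *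
        ((p.1 - α) * (β - p.1))) * Complex.I_sq
    rw [e1, Complex.add_re, Complex.re_mul_ofReal, Complex.re_mul_ofReal]
    have h3 : ‖Complex.I * s * ζ * (v (X p) * planeWave e κ (X p))‖ ≤ b := by
      rw [norm_mul, norm_mul, norm_mul, norm_mul, norm_planeWave, Complex.norm_I, Complex.norm_real,
        Real.norm_eq_abs, hs, hζ]
      simpa using hvb _ hx
    have h4 : |(Complex.I * s * ζ * (v (X p) * planeWave e κ (X p))).re * (α + β - 2 * p.1)| ≤
        b * (β - α) := by
      rw [abs_mul]
      have := (Complex.abs_re_le_norm _).trans h3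
      have hb := (norm_nonneg _).trans h3
      gcongr
    have h5 : a * (|κ| * (1 / 2) * ((p.1 - α) * (β - p.1))) ≤
        (ζ * (v (X p) * planeWave e κ (X p))).re *
          (|κ| * ⟪e, τ (X p)⟫ * ((p.1 - α) * (β - p.1))) := by
      have h6 := hS.inner_ge _ hx
      have h7 := hva _ hx
      have h8 : 0 ≤ (ζ * (v (X p) * planeWave e κ (X p))).re := ha.trans h7
      gcongr
    linarith [(abs_le.1 h4).1]
  have hI1 : Integrable (fun t : ℝ => a * |κ| / 2 * ((t - α) * (β - t)) - b * (β - α))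
      (volume.restrict (Icc α β)) := (Continuous.integrableOn_Icc (by fun_prop))
  have hint : ∫ p : ℝ × ℝ, (a * |κ| / 2 * ((p.1 - α) * (β - p.1)) - b * (β - α))
      ∂paramMeasure α β W ν = ν.real W * (a * |κ| * (β - α) ^ 3 / 12 - b * (β - α) ^ 2) := by
    have := integral_fun_fst (μ := volume.restrict (Icc α β)) (ν := ν.restrict W)
      (fun t : ℝ => a * |κ| / 2 * ((t - α) * (β - t)) - b * (β - α))
    refine this.trans ?_
    have hc : IntegrableOn (fun t : ℝ => a * |κ| / 2 * ((t - α) * (β - t))) (Icc α β) :=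
      Continuous.integrableOn_Icc (by fun_prop)
    rw [integral_sub hc (integrable_const _), integral_const_mul, setIntegral_cutoff hS.lt.le,
      integral_const, smul_eq_mul, smul_eq_mul, measureReal_restrict_apply_univ,
      measureReal_restrict_apply_univ, Real.volume_real_Icc_of_le hS.lt.le]
    ring
  rw [← hint]
  calc _ ≤ ∫ p, (η * F p).re ∂paramMeasure α β W ν :=
        integral_mono_ae (hI1.comp_fst _) (hFi.const_mul η).re hlow
    _ = (∫ p, η * F p ∂paramMeasure α β W ν).re := integral_re (hFi.const_mul η)
    _ ≤ ‖∫ p, η * F p ∂paramMeasure α β W ν‖ := Complex.re_le_norm _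
    _ = _ := by rw [integral_const_mul, norm_mul, hηn, one_mul]

/-- A function that behaves like the plane wave `e^{iκ e·x}` on a strip has a large surface
gradient. -/
lemma le_normH1 (hS : IsBoundaryStrip Ω e α β W ν K S X τ) (he : ‖e‖ = 1) (hK : 0 < K)
    (hν : 0 < ν.real W) {v : Space d → ℂ} {κ a b : ℝ} {ζ : ℂ} (hζ : ‖ζ‖ = 1) (ha : 0 ≤ a)
    (hva : ∀ x ∈ S, a ≤ (ζ * (v x * planeWave e κ x)).re) (hvb : ∀ x ∈ S, ‖v x‖ ≤ b)
    (hκ : 24 * b ≤ a * (β - α) * |κ|) :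
    ENNReal.ofReal (a * |κ| * √((β - α) * ν.real W) / √K / 48) ≤ normH1 Ω v := by
  refine le_iInf₂ fun g hg => ?_
  have hL : 0 < β - α := sub_pos.2 hS.lt
  have h1 := hS.le_norm_integral_mul_testWeight he hg.1.1 hζ ha hva hvb
  have h2 := hS.enorm_integral_mul_testWeight_le_of_hasSurfaceGradient he κ hg hvb
  have hKr : (0 : ℝ) < K := by exact_mod_cast hK
  set T := ν.real W
  set P := √(K * ((β - α) * T)) with hP
  have hP0 : 0 < P := Real.sqrt_pos.2 (by positivity)
  have hPsq : P ^ 2 = K * ((β - α) * T) := Real.sq_sqrt (by positivity)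
  -- By `hκ` the error `b(β - α)²` is at most half of the main term, so `1/12` drops to `1/24`; the
  -- factor `2` from `‖τ‖ ≤ 2` then gives `48`.
  have h3 : a * |κ| * √((β - α) * T) / √K / 48 * ((β - α) ^ 2 * P * 2) ≤
      T * (a * |κ| * (β - α) ^ 3 / 12 - b * (β - α) ^ 2) := by
    have e1 : P = √K * √((β - α) * T) := Real.sqrt_mul hKr.le _
    have hsK : 0 < √(K : ℝ) := Real.sqrt_pos.2 hKr
    have e2 : √((β - α) * T) * √((β - α) * T) = (β - α) * T := Real.mul_self_sqrt (by positivity)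
    have e3 : a * |κ| * √((β - α) * T) / √K / 48 * ((β - α) ^ 2 * P * 2) =
        a * |κ| * (β - α) ^ 2 / 24 * (√((β - α) * T) * √((β - α) * T)) := by
      rw [e1]; field_simp; ring
    rw [e3, e2]
    have h5 : 0 ≤ T * (β - α) ^ 2 := by positivity
    nlinarith [mul_le_mul_of_nonneg_right hκ h5]
  have h4 : ENNReal.ofReal (a * |κ| * √((β - α) * T) / √K / 48) *
      ENNReal.ofReal ((β - α) ^ 2 * P * 2) ≤
      eLpNorm g 2 (surfaceMeasure Ω) * ENNReal.ofReal ((β - α) ^ 2 * P * 2) := by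
    rw [← ENNReal.ofReal_mul (by positivity)]
    refine (ENNReal.ofReal_le_ofReal (h3.trans h1)).trans ?_
    rw [ofReal_norm]
    refine h2.trans_eq ?_
    rw [ENNReal.ofReal_mul (by positivity), ENNReal.ofReal_mul (by positivity)]
    norm_num
    ring
  rw [ENNReal.mul_le_mul_iff_left (by simpa using by positivity) ENNReal.ofReal_ne_top] at h4
  refine h4.trans ?_
  calc eLpNorm g 2 (surfaceMeasure Ω)
      = (eLpNorm g 2 (surfaceMeasure Ω) ^ 2) ^ (1 / 2 : ℝ) := by
        rw [← ENNReal.rpow_natCast, ← ENNReal.rpow_mul]; norm_num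
    _ ≤ _ := ENNReal.rpow_le_rpow le_add_self (by norm_num)

end IsBoundaryStrip

/-- Lower bounds for both operator norms from one function. -/
lemma le_opNorm {d : ℕ} {Ω : Set (Space d)} {N : (Space d → ℂ) → ℝ≥0∞}
    {T : (Space d → ℂ) → Space d → ℂ} {φ : Space d → ℂ} (hφ : MemLp φ 2 (surfaceMeasure Ω))
    (h1 : normL2 Ω φ ≤ 1) : N (T φ) ≤ opNorm Ω N T :=
  le_iSup_of_le φ (le_iSup₂_of_le hφ h1 le_rfl)

open IsBoundaryStrip

/-- Near `t` the curve maps the whole line into the boundary, so its derivative sends the direction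
`1` into the tangent cone. -/
lemma mem_tangentSpan_of_hasDerivAt {d : ℕ} {Ω : Set (Space d)} {c : ℝ → Space d} {c' : Space d}
    {t : ℝ} (hc : HasDerivAt c c' t) (hmem : ∀ᶠ s in 𝓝 t, c s ∈ frontier Ω) :
    c' ∈ tangentSpan Ω (c t) := by
  refine Submodule.subset_span ?_
  obtain ⟨U, hU, hUs⟩ : ∃ U ∈ 𝓝 t, U ⊆ c ⁻¹' frontier Ω := ⟨_, hmem, subset_rfl⟩
  have h0 : (1 : ℝ) ∈ tangentConeAt ℝ U t := by rw [tangentConeAt_of_mem_nhds hU]; trivial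
  have h1 := (hc.hasFDerivAt.hasFDerivWithinAt (s := U)).mapsTo_tangent_cone h0
  have h2 := tangentConeAt_mono (𝕜 := ℝ) (x := c t) (image_subset_iff.2 hUs) h1
  simpa using h2

/-! ### Normalised plane waves on a piece of the boundary -/

/-- The plane wave `e^{iκ e·y}` restricted to `S` and normalised in `L²(∂Ω)`. -/
def planeWavePacket {d : ℕ} (Ω : Set (Space d)) (e : Space d) (κ : ℝ) (S : Set (Space d)) :
    Space d → ℂ :=
  S.indicator fun y => ((√((surfaceMeasure Ω).real S))⁻¹ : ℝ) * planeWave e (-κ) y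

section Packet

variable {d : ℕ} {Ω : Set (Space d)} {e : Space d} {κ : ℝ} {S : Set (Space d)}

lemma memLp_planeWavePacket (hS : MeasurableSet S) (hfin : surfaceMeasure Ω S ≠ ⊤) :
    MemLp (planeWavePacket Ω e κ S) 2 (surfaceMeasure Ω) := by
  rw [planeWavePacket, memLp_indicator_iff_restrict hS]
  have : IsFiniteMeasure ((surfaceMeasure Ω).restrict S) := ⟨by simpa using hfin.lt_top⟩
  refine MemLp.of_bound (((continuous_planeWave e (-κ)).const_mul _).aestronglyMeasurable)
    (√((surfaceMeasure Ω).real S))⁻¹ (Eventually.of_forall fun y => ?_)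
  rw [norm_mul, norm_planeWave, mul_one, Complex.norm_real, Real.norm_eq_abs,
    abs_of_nonneg (by positivity)]

lemma normL2_planeWavePacket_le (hS : MeasurableSet S) (hfin : surfaceMeasure Ω S ≠ ⊤) :
    normL2 Ω (planeWavePacket Ω e κ S) ≤ 1 := by
  have h1 : normL2 Ω (planeWavePacket Ω e κ S) ≤ eLpNorm
      (S.indicator fun _ => (√((surfaceMeasure Ω).real S))⁻¹) 2 (surfaceMeasure Ω) := by
    refine eLpNorm_mono fun y => ?_
    by_cases hy : y ∈ S
    · rw [planeWavePacket, indicator_of_mem hy, indicator_of_mem hy, norm_mul, norm_planeWave,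
        mul_one, Complex.norm_real]
    · rw [planeWavePacket, indicator_of_notMem hy]; simp
  refine h1.trans ?_
  rw [eLpNorm_indicator_const hS (by norm_num) (by norm_num), ← ofReal_measureReal hfin,
    Real.enorm_eq_ofReal (by positivity), ENNReal.ofReal_rpow_of_nonneg (by positivity) (by norm_num),
    ← ENNReal.ofReal_mul (by positivity)]
  have : (1 / (2 : ℝ≥0∞).toReal) = 1 / 2 := by norm_num
  rw [this, ← Real.sqrt_eq_rpow]
  -- Only an inequality is claimed: if `S` is null, the inverse is `0` and so is the packet.
  exact ENNReal.ofReal_le_one.2 (inv_mul_le_one)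

/-- Demodulating the potential at `x` combines the two plane waves into one in `x - y`, so kernel
and wave can be compared as functions of the difference alone. -/
lemma singleLayer_planeWavePacket_mul (hS : MeasurableSet S) (k : ℝ) (x : Space d) :
    singleLayer Ω k (planeWavePacket Ω e κ S) x * planeWave e κ x =
      ((√((surfaceMeasure Ω).real S))⁻¹ : ℝ) *
        ∫ y in S, fundamentalSolution d k x y * planeWave e κ (x - y) ∂(surfaceMeasure Ω) := by
  have h1 : ∀ y, fundamentalSolution d k x y * planeWavePacket Ω e κ S y =
      S.indicator (fun y => fundamentalSolution d k x y *
        (((√((surfaceMeasure Ω).real S))⁻¹ : ℝ) * planeWave e (-κ) y)) y := fun y => by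
    by_cases hy : y ∈ S
    · rw [planeWavePacket, indicator_of_mem hy, indicator_of_mem hy]
    · rw [planeWavePacket, indicator_of_notMem hy, indicator_of_notMem hy, mul_zero]
  rw [singleLayer, integral_congr_ae (Eventually.of_forall h1), integral_indicator hS,
    ← integral_mul_const, ← integral_const_mul]
  refine integral_congr_ae (Eventually.of_forall fun y => ?_)
  have h2 : planeWave e (-κ) y * planeWave e κ x = planeWave e κ (x - y) := by
    simp only [planeWave]
    rw [← Complex.exp_add, inner_sub_right]
    congr 1
    push_cast
    ring
  beta_reduce
  rw [← h2]
  ring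

end Packet

/-! ### Boundaries of plane domains containing a segment -/

section Segment

variable {d : ℕ} {a e : Space d}

lemma isometry_line (he : ‖e‖ = 1) : Isometry fun t : ℝ => a + t • e := by
  refine Isometry.of_dist_eq fun s t => ?_
  rw [dist_add_left, dist_eq_norm, ← sub_smul, norm_smul, he, mul_one, Real.dist_eq,
    Real.norm_eq_abs]

/-- The normalisation factor between one-dimensional surface measure and length. -/
def lengthFactor : ℝ≥0 :=
  Measure.addHaarScalarFactor (volume : Measure (EuclideanSpace ℝ (Fin 1))) μH[(1 : ℕ)]

lemma lengthFactor_pos : 0 < lengthFactor :=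
  pos_iff_ne_zero.2 (Measure.addHaarScalarFactor_volume_hausdorffMeasure_ne_zero 1)

/-- The parametrisation of the line is an isometry, so it carries length to one-dimensional
Hausdorff measure; only the normalising constant remains. -/
lemma surfaceMeasure_restrict_segment {Ω : Set (Space 2)} {a e : Space 2} (he : ‖e‖ = 1)
    {J : Set ℝ} (hJ : IsCompact J) (hJΩ : ∀ t ∈ J, a + t • e ∈ frontier Ω) :
    (surfaceMeasure Ω).restrict ((fun t : ℝ => a + t • e) '' J) =
      lengthFactor • Measure.map (fun t : ℝ => a + t • e) (volume.restrict J) := by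
  have hiso := isometry_line (a := a) he
  have hm : MeasurableSet ((fun t : ℝ => a + t • e) '' J) :=
    (hJ.image hiso.continuous).measurableSet
  have hsub : (fun t : ℝ => a + t • e) '' J ⊆ frontier Ω := image_subset_iff.2 hJΩ
  have h1 : Measure.map (fun t : ℝ => a + t • e) volume =
      (μH[1] : Measure (Space 2)).restrict (range fun t : ℝ => a + t • e) := by
    rw [← hausdorffMeasure_real]
    exact hiso.map_hausdorffMeasure (Or.inl zero_le_one)
  have h2 : (μHE[2 - 1] : Measure (Space 2)) = lengthFactor • μH[1] := by
    rw [Measure.euclideanHausdorffMeasure_def]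
    simp [lengthFactor]
  rw [surfaceMeasure, Measure.restrict_restrict hm, inter_eq_self_of_subset_left hsub, h2,
    Measure.restrict_smul]
  congr 1
  have h3 : J = (fun t : ℝ => a + t • e) ⁻¹' ((fun t : ℝ => a + t • e) '' J) :=
    (preimage_image_eq J hiso.injective).symm
  conv_rhs => rw [h3, ← Measure.restrict_map hiso.continuous.measurable hm, h1,
    Measure.restrict_restrict hm, inter_eq_self_of_subset_left (image_subset_range _ _)]

end Segment

/-! ### From one packet to both operator norms, and the planar case -/

/-- If the single layer potential of a plane wave packet behaves like the plane wave on a strip,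
both operator norms are bounded below. -/
lemma le_opNorm_of_strip {d : ℕ} {Ω : Set (Space d)} {e : Space d} {α β : ℝ} {W : Set ℝ}
    {ν : Measure ℝ} {K : ℝ≥0} {S S₁ : Set (Space d)} {X : ℝ × ℝ → Space d} {τ : Space d → Space d}
    (hS : IsBoundaryStrip Ω e α β W ν K S X τ) (he : ‖e‖ = 1) (hK : 0 < K) (hν : 0 < ν.real W)
    (hS₁ : MeasurableSet S₁) (hfin : surfaceMeasure Ω S₁ ≠ ⊤) {κ k a b C : ℝ} {ζ : ℂ}
    (hκ : |κ| = k) (hk : 0 < k) (hζ : ‖ζ‖ = 1) (ha : 0 ≤ a)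
    (hva : ∀ x ∈ S, a ≤ (ζ * (singleLayer Ω k (planeWavePacket Ω e κ S₁) x *
      planeWave e κ x)).re)
    (hvb : ∀ x ∈ S, ‖singleLayer Ω k (planeWavePacket Ω e κ S₁) x * planeWave e κ x‖ ≤ b)
    (hab : 24 * b ≤ a * (β - α) * k) (hC0 : 0 ≤ C)
    (hC : 48 * C / √k ≤ a * √((β - α) * ν.real W) / √K) :
    ENNReal.ofReal (C * k ^ (-(1 / 2) : ℝ)) ≤ opNorm Ω (normL2 Ω) (singleLayer Ω k) ∧
    ENNReal.ofReal (C * k ^ (1 / 2 : ℝ)) ≤ opNorm Ω (normH1 Ω) (singleLayer Ω k) := by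
  have hφ := memLp_planeWavePacket (e := e) (κ := κ) hS₁ hfin
  have hφ1 := normL2_planeWavePacket_le (e := e) (κ := κ) hS₁ hfin
  have hvb' : ∀ x ∈ S, ‖singleLayer Ω k (planeWavePacket Ω e κ S₁) x‖ ≤ b := fun x hx => by
    have := hvb x hx
    rwa [norm_mul, norm_planeWave, mul_one] at this
  have hva' : ∀ x ∈ S, a ≤ ‖singleLayer Ω k (planeWavePacket Ω e κ S₁) x‖ := fun x hx => by
    have := (hva x hx).trans (Complex.re_le_norm _)
    rwa [norm_mul, norm_mul, norm_planeWave, mul_one, hζ, one_mul] at this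
  have hsk : 0 < √k := Real.sqrt_pos.2 hk
  have hk2 : √k * √k = k := Real.mul_self_sqrt hk.le
  constructor
  · refine le_trans (ENNReal.ofReal_le_ofReal ?_)
      ((hS.le_normL2 ha hK hva').trans (le_opNorm hφ hφ1))
    refine le_trans ?_ hC
    rw [Real.rpow_neg hk.le, ← Real.sqrt_eq_rpow, ← div_eq_mul_inv]
    gcongr
    linarith
  · refine le_trans (ENNReal.ofReal_le_ofReal ?_)
      ((hS.le_normH1 he hK hν hζ ha hva hvb' (by rwa [hκ])).trans (le_opNorm hφ hφ1))
    rw [hκ, ← Real.sqrt_eq_rpow]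
    have h1 : C * √k = 48 * C / √k * k / 48 := by
      field_simp
      nlinarith
    have h2 : a * k * √((β - α) * ν.real W) / √K / 48 =
        a * √((β - α) * ν.real W) / √K * k / 48 := by ring
    rw [h1, h2]
    gcongr

/-- In the plane the strip degenerates to a single curve: the transverse parameter set is one point
carrying a Dirac mass, and the tangent field is constantly `e`. -/
lemma isBoundaryStrip_segment {Ω : Set (Space 2)} {a e : Space 2} {δ α β : ℝ} (he : ‖e‖ = 1)
    (hseg : lineSegment a e δ ⊆ frontier Ω) (hα : -δ < α) (hαβ : α < β) (hβ : β < δ) :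
    IsBoundaryStrip Ω e α β {0} (Measure.dirac 0) lengthFactor⁻¹
      ((fun t : ℝ => a + t • e) '' Icc α β) (fun p => a + p.1 • e) (fun _ => e) := by
  have hcont : Continuous fun t : ℝ => a + t • e := by fun_prop
  have hmem : ∀ t : ℝ, |t| < δ → a + t • e ∈ frontier Ω := fun t ht => hseg ⟨t, ht, rfl⟩
  have habs : ∀ t ∈ Icc α β, |t| < δ := fun t ht => abs_lt.2 ⟨by linarith [ht.1], by linarith [ht.2]⟩
  have hder : ∀ t : ℝ, HasDerivAt (fun t : ℝ => a + t • e) e t := fun t => by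
    simpa using ((hasDerivAt_id t).smul_const e).const_add a
  refine ⟨hαβ, measurableSet_singleton 0, by simp, (isCompact_Icc.image hcont).measurableSet,
    by fun_prop, measurable_const, ?_, fun t ht w _ => ⟨t, ht, rfl⟩, fun t _ w _ => hder t, ?_,
    fun x _ => by rw [he]; norm_num, fun x _ => by rw [real_inner_self_eq_norm_sq, he]; norm_num⟩
  · have h1 : Measure.map (fun p : ℝ × ℝ => a + p.1 • e) ((volume.restrict (Icc α β)).prod
        ((Measure.dirac (0 : ℝ)).restrict {0})) =
        Measure.map (fun t : ℝ => a + t • e) (volume.restrict (Icc α β)) := by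
      have h2 : (fun p : ℝ × ℝ => a + p.1 • e) = (fun t : ℝ => a + t • e) ∘ Prod.fst := rfl
      rw [h2, ← Measure.map_map hcont.measurable measurable_fst, Measure.map_fst_prod]
      simp
    have h3 := surfaceMeasure_restrict_segment he isCompact_Icc
      (fun t ht => hmem t (habs t ht))
    rw [h1]
    calc Measure.map (fun t : ℝ => a + t • e) (volume.restrict (Icc α β))
        = lengthFactor⁻¹ • (surfaceMeasure Ω).restrict ((fun t : ℝ => a + t • e) '' Icc α β) := by
          rw [h3, smul_smul, inv_mul_cancel₀ lengthFactor_pos.ne', one_smul]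
      _ ≤ lengthFactor⁻¹ • surfaceMeasure Ω := by
          refine Measure.le_iff.2 fun A _ => ?_
          rw [Measure.smul_apply, Measure.smul_apply, ENNReal.smul_def, ENNReal.smul_def]
          exact mul_le_mul_right (Measure.restrict_apply_le _ _) _
  · rintro x ⟨t, ht, rfl⟩
    refine mem_tangentSpan_of_hasDerivAt (c := fun t : ℝ => a + t • e) (t := t) (hder t) ?_
    filter_upwards [continuous_abs.continuousAt.eventually_lt continuousAt_const (habs t ht)]
      with s hs using hmem s hs

/-- The case of the plane. -/
theorem exists_opNorm_bounds_two {Ω : Set (Space 2)} {a e : Space 2} {δ : ℝ} (he : ‖e‖ = 1)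
    (hδ : 0 < δ) (hseg : lineSegment a e δ ⊆ frontier Ω) :
    ∃ k₀ C : ℝ, 0 < k₀ ∧ 0 < C ∧ ∀ k : ℝ, k₀ ≤ k →
      ENNReal.ofReal (C * k ^ (-(1 / 2) : ℝ)) ≤ opNorm Ω (normL2 Ω) (singleLayer Ω k) ∧
      ENNReal.ofReal (C * k ^ (1 / 2 : ℝ)) ≤ opNorm Ω (normH1 Ω) (singleLayer Ω k) := by
  -- The source occupies parameters `[-2ρ, -ρ]` and the target `[ρ, 2ρ]`. For fixed target parameter
  -- `t` the distances fill an interval of length `ρ` starting at `t + ρ ∈ [2ρ, 3ρ]`.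
  set ρ : ℝ := δ / 3 with hρ
  have hρ0 : 0 < ρ := by positivity
  obtain ⟨s, ζ, c, C', k₀, hs, hζ, hc, hC', hk₀, hH⟩ :=
    exists_hankelH0_integral_bounds (r₀ := 2 * ρ) (r₁ := 3 * ρ) (ℓ := ρ) (by positivity)
      (by linarith) hρ0
  have hcont : Continuous fun t : ℝ => a + t • e := by fun_prop
  have hstrip := isBoundaryStrip_segment (a := a) (α := ρ) (β := 2 * ρ) he hseg (by linarith)
    (by linarith) (by linarith)
  have hI₁ : ∀ t ∈ Icc (-(2 * ρ)) (-ρ), a + t • e ∈ frontier Ω := fun t ht =>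
    hseg ⟨t, abs_lt.2 ⟨by linarith [ht.1], by linarith [ht.2]⟩, rfl⟩
  set S₁ : Set (Space 2) := (fun t : ℝ => a + t • e) '' Icc (-(2 * ρ)) (-ρ) with hS₁
  have hmS₁ : MeasurableSet S₁ := (isCompact_Icc.image hcont).measurableSet
  have hres := surfaceMeasure_restrict_segment he isCompact_Icc hI₁
  have hσ : surfaceMeasure Ω S₁ = lengthFactor * ENNReal.ofReal ρ := by
    have h1 : (surfaceMeasure Ω).restrict S₁ univ = surfaceMeasure Ω S₁ := by simp
    rw [← h1, hres, Measure.smul_apply, Measure.map_apply hcont.measurable MeasurableSet.univ]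
    simp only [preimage_univ, Measure.restrict_apply_univ, Real.volume_Icc]
    rw [ENNReal.smul_def, smul_eq_mul]
    congr 2
    ring
  have hfin : surfaceMeasure Ω S₁ ≠ ⊤ := by
    rw [hσ]; exact ENNReal.mul_ne_top ENNReal.coe_ne_top ENNReal.ofReal_ne_top
  have hcf : (0 : ℝ) < lengthFactor := by exact_mod_cast lengthFactor_pos
  have hσr : (surfaceMeasure Ω).real S₁ = lengthFactor * ρ := by
    rw [measureReal_def, hσ, ENNReal.toReal_mul, ENNReal.toReal_ofReal hρ0.le]
    rfl
  -- Normalisation of the packet, density of surface measure, and the `1/4` of the kernel; the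
  -- remaining factor `i` is undone by `-i` in the choice of `ζ` below.
  set n : ℝ := (√(lengthFactor * ρ))⁻¹ * lengthFactor / 4 with hn
  have hn0 : 0 < n := by
    have : 0 < √(lengthFactor * ρ) := Real.sqrt_pos.2 (by positivity)
    positivity
  have hv : ∀ k, 0 < k → ∀ t ∈ Icc ρ (2 * ρ),
      singleLayer Ω k (planeWavePacket Ω e (s * k) S₁) (a + t • e) * planeWave e (s * k) (a + t • e)
      = Complex.I * (n * ∫ r in (t + ρ)..(t + ρ) + ρ,
          hankelH0 (k * r) * Complex.exp (-(Complex.I * (s * k * r : ℝ)))) := by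
    intro k hk t ht
    rw [singleLayer_planeWavePacket_mul hmS₁, hres, hσr, integral_smul_nnreal_measure,
      (isometry_line (a := a) he).isClosedEmbedding.measurableEmbedding.integral_map,
      integral_Icc_eq_integral_Ioc, ← intervalIntegral.integral_of_le (by linarith)]
    have h1 : ∀ t' ∈ uIcc (-(2 * ρ)) (-ρ), fundamentalSolution 2 k (a + t • e) (a + t' • e) *
        planeWave e (s * k) (a + t • e - (a + t' • e)) =
        Complex.I / 4 * (hankelH0 (k * (t - t')) *
          Complex.exp (-(Complex.I * (s * k * (t - t') : ℝ)))) := by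
      intro t' ht'
      rw [uIcc_of_le (by linarith)] at ht'
      have h2 : a + t • e - (a + t' • e) = (t - t') • e := by rw [sub_smul]; abel
      rw [fundamentalSolution, if_pos rfl, planeWave, h2, norm_smul, he, mul_one, Real.norm_eq_abs,
        abs_of_pos (by linarith [ht.1, ht'.2]), inner_smul_right, real_inner_self_eq_norm_sq, he,
        mul_assoc]
      norm_num
    rw [intervalIntegral.integral_congr h1, intervalIntegral.integral_const_mul,
      intervalIntegral.integral_comp_sub_left (fun r => hankelH0 (k * r) *
          Complex.exp (-(Complex.I * (s * k * r : ℝ)))) t]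
    have e1 : t - -ρ = t + ρ := by ring
    have e2 : t - -(2 * ρ) = t + ρ + ρ := by ring
    rw [e1, e2, hn, NNReal.smul_def, Complex.real_smul]
    push_cast
    ring
  set A : ℝ := n * c * √((2 * ρ - ρ) * (Measure.dirac (0 : ℝ)).real {0}) / √((lengthFactor⁻¹ : ℝ≥0) : ℝ)
    with hA
  have hd1 : (Measure.dirac (0 : ℝ)).real {0} = 1 := by
    rw [measureReal_def, Measure.dirac_apply_of_mem (mem_singleton _), ENNReal.toReal_one]
  have hA0 : 0 < A := by
    have h1 : 0 < √((lengthFactor⁻¹ : ℝ≥0) : ℝ) := Real.sqrt_pos.2 (by push_cast; positivity)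
    have h2 : 0 < √((2 * ρ - ρ) * (Measure.dirac (0 : ℝ)).real {0}) :=
      Real.sqrt_pos.2 (by rw [hd1]; linarith)
    positivity
  -- The second threshold gives the condition `24 b ≤ a (β - α) k`; the factor `n / √k` common to
  -- `a` and `b` drops out of it.
  refine ⟨max k₀ (24 * C' / (c * ρ)), A / 48, lt_max_of_lt_left hk₀, by positivity, fun k hk => ?_⟩
  have hkk : k₀ ≤ k := (le_max_left _ _).trans hk
  have hk0 : 0 < k := hk₀.trans_le hkk
  have hsk : 0 < √k := Real.sqrt_pos.2 hk0
  refine le_opNorm_of_strip hstrip he (inv_pos.2 lengthFactor_pos) (by rw [hd1]; exact one_pos) hmS₁ hfin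
    (κ := s * k) (a := n * (c / √k)) (b := n * (C' / √k)) (ζ := ζ * -Complex.I)
    (by rw [abs_mul, hs, one_mul, abs_of_pos hk0]) hk0 (by simp [hζ]) (by positivity) ?_ ?_ ?_
    (by positivity) ?_
  · rintro x ⟨t, ht, rfl⟩
    beta_reduce
    rw [hv k hk0 t ht]
    have h1 := (hH k hkk (t + ρ) ⟨by linarith [ht.1], by linarith [ht.2]⟩).1
    set J := ∫ r in (t + ρ)..(t + ρ) + ρ,
      hankelH0 (k * r) * Complex.exp (-(Complex.I * (s * k * r : ℝ)))
    have h2 : ζ * -Complex.I * (Complex.I * (n * J)) = (n : ℂ) * (ζ * J) := by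
      linear_combination (-ζ * n * J) * Complex.I_sq
    rw [h2, Complex.re_ofReal_mul]
    gcongr
  · rintro x ⟨t, ht, rfl⟩
    beta_reduce
    rw [hv k hk0 t ht]
    have h1 := (hH k hkk (t + ρ) ⟨by linarith [ht.1], by linarith [ht.2]⟩).2
    rw [norm_mul, norm_mul, Complex.norm_I, one_mul, Complex.norm_real, Real.norm_eq_abs,
      abs_of_pos hn0]
    gcongr
  · have h1 : 24 * C' / (c * ρ) ≤ k := (le_max_right _ _).trans hk
    rw [div_le_iff₀ (by positivity)] at h1
    have h2 : n * (c / √k) * (2 * ρ - ρ) * k = n / √k * (k * (c * ρ)) := by ring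
    have h3 : 24 * (n * (C' / √k)) = n / √k * (24 * C') := by ring
    rw [h2, h3]
    gcongr
  · rw [hA]
    refine le_of_eq ?_
    ring

/-! ### Charts of `C²` surfaces along a segment -/

/-- `X` parametrises part of `∂Ω`, sending the first coordinate axis to the line through `a` in
direction `e`, with Lipschitz left inverse `Y`. -/
structure IsSegmentChart {d : ℕ} (Ω : Set (Space d)) (a e : Space d) (ρ : ℝ) (KX KY : ℝ≥0)
    (X : ℝ × ℝ → Space d) (Y : Space d → ℝ × ℝ) : Prop where
  pos : 0 < ρ
  contDiff : ContDiff ℝ 1 X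
  lipschitz_inv : LipschitzWith KY Y
  left_inv : ∀ p, Y (X p) = p
  mem : ∀ p ∈ Metric.ball (0 : ℝ × ℝ) ρ, X p ∈ frontier Ω
  axis : ∀ t, |t| < ρ → X (t, 0) = a + t • e
  lipschitz : LipschitzOnWith KX X (Metric.ball 0 ρ)
  deriv_near : ∀ p ∈ Metric.ball (0 : ℝ × ℝ) ρ, ‖fderiv ℝ X p (1, 0) - e‖ ≤ 1 / 2

lemma exists_unit_orthogonal_pair (u v : Space 3) :
    ∃ n : Space 3, ‖n‖ = 1 ∧ ⟪n, u⟫ = 0 ∧ ⟪n, v⟫ = 0 := by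
  have hne : (Submodule.span ℝ ({u, v} : Set (Space 3)))ᗮ ≠ ⊥ := fun h => by
    rw [Submodule.orthogonal_eq_bot_iff] at h
    have h1 : Module.finrank ℝ (Submodule.span ℝ ({u, v} : Set (Space 3))) ≤ 2 := by
      classical
      have := finrank_span_finset_le_card (R := ℝ) ({u, v} : Finset (Space 3))
      simp only [Finset.coe_insert, Finset.coe_singleton] at this
      exact this.trans Finset.card_le_two
    rw [h, finrank_top, finrank_euclideanSpace_fin] at h1
    omega
  obtain ⟨m, hm, hm0⟩ := Submodule.exists_mem_ne_zero_of_ne_bot hne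
  have hu := hm u (Submodule.subset_span (by simp))
  have hv := hm v (Submodule.subset_span (by simp))
  refine ⟨‖m‖⁻¹ • m, ?_, ?_, ?_⟩
  · rw [norm_smul, norm_inv, norm_norm, inv_mul_cancel₀ (norm_ne_zero_iff.2 hm0)]
  · rw [inner_smul_left, real_inner_comm, hu, mul_zero]
  · rw [inner_smul_left, real_inner_comm, hv, mul_zero]

/-- Differentiating `X (t, 0) = a + t • e` gives derivative exactly `e` at the origin. Continuity of
the derivative and local Lipschitz continuity of a `C¹` map supply the other bounds on a small ball.
-/
lemma IsSegmentChart.of_eventually {d : ℕ} {Ω : Set (Space d)} {a e : Space d} {KY : ℝ≥0}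
    {X : ℝ × ℝ → Space d} {Y : Space d → ℝ × ℝ} (hX : ContDiff ℝ 1 X) (hY : LipschitzWith KY Y)
    (hYX : ∀ p, Y (X p) = p) (hmem : ∀ᶠ p in 𝓝 (0 : ℝ × ℝ), X p ∈ frontier Ω)
    (haxis : ∀ᶠ t in 𝓝 (0 : ℝ), X (t, 0) = a + t • e) :
    ∃ ρ KX, IsSegmentChart Ω a e ρ KX KY X Y := by
  obtain ⟨KX, U, hU, hKX⟩ := hX.contDiffAt (x := 0) |>.exists_lipschitzOnWith
  have hd0 : fderiv ℝ X 0 (1, 0) = e := by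
    have h1 : HasDerivAt (fun t : ℝ => ((t, 0) : ℝ × ℝ)) (1, 0) 0 :=
      (hasDerivAt_id _).prodMk (hasDerivAt_const _ _)
    have h2 : HasDerivAt (fun t : ℝ => X (t, 0)) (fderiv ℝ X 0 (1, 0)) 0 :=
      HasFDerivAt.comp_hasDerivAt (f := fun t : ℝ => ((t, 0) : ℝ × ℝ)) (0 : ℝ)
        ((hX.differentiable one_ne_zero).differentiableAt.hasFDerivAt) h1
    have h3 : HasDerivAt (fun t : ℝ => a + t • e) e 0 := by
      simpa using ((hasDerivAt_id (0 : ℝ)).smul_const e).const_add a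
    exact h2.unique (h3.congr_of_eventuallyEq haxis)
  have hc : Continuous fun p => ‖fderiv ℝ X p (1, 0) - e‖ :=
    (((hX.continuous_fderiv one_ne_zero).clm_apply continuous_const).sub continuous_const).norm
  have hder : ∀ᶠ p in 𝓝 (0 : ℝ × ℝ), ‖fderiv ℝ X p (1, 0) - e‖ < 1 / 2 :=
    hc.continuousAt.eventually (gt_mem_nhds (by simp only [hd0]; norm_num))
  obtain ⟨ρ₁, hρ₁, h₁⟩ := Metric.eventually_nhds_iff_ball.1 ((hmem.and hder).and hU)
  obtain ⟨ρ₂, hρ₂, h₂⟩ := Metric.eventually_nhds_iff_ball.1 haxis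
  have hsub : Metric.ball (0 : ℝ × ℝ) (min ρ₁ ρ₂) ⊆ Metric.ball 0 ρ₁ :=
    Metric.ball_subset_ball (min_le_left _ _)
  exact ⟨min ρ₁ ρ₂, KX, lt_min hρ₁ hρ₂, hX, hY, hYX, fun p hp => (h₁ p (hsub hp)).1.1,
    fun t ht => h₂ t (by rw [mem_ball_zero_iff]; exact ht.trans_le (min_le_right _ _)),
    hKX.mono fun p hp => (h₁ p (hsub hp)).2, fun p hp => (h₁ p (hsub hp)).1.2.le⟩

/-- A `C²` surface in space containing a segment has a chart along it. -/
lemma exists_isSegmentChart {Ω : Set (Space 3)} {a e : Space 3} (he : ‖e‖ = 1)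
    (haxis : ∀ᶠ t in 𝓝 (0 : ℝ), a + t • e ∈ frontier Ω) (hC2 : IsC2BoundaryAt Ω a) :
    ∃ ρ KX KY X Y, IsSegmentChart Ω a e ρ KX KY X Y := by
  obtain ⟨ν, γ, hν, hγ, hgraph⟩ := hC2
  -- The vector `n` is the transverse direction in the base plane: orthogonal to `ν`, hence fixed by
  -- `P`, and orthogonal to `e`, hence to `P e`.
  obtain ⟨n, hn, hnν, hne⟩ := exists_unit_orthogonal_pair ν e
  set P := (ℝ ∙ ν)ᗮ.orthogonalProjectionOnto with hP
  have hdec : ∀ x : Space 3, x = (P x : Space 3) + ⟪ν, x⟫ • ν := fun x => by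
    have h1 := Submodule.starProjection_add_starProjection_orthogonal (K := ℝ ∙ ν) x
    rw [Submodule.starProjection_unit_singleton ℝ hν x] at h1
    rw [add_comm]
    exact h1.symm
  have hPν : ∀ y : (ℝ ∙ ν)ᗮ, ⟪ν, (y : Space 3)⟫ = 0 := fun y =>
    Submodule.mem_orthogonal_singleton_iff_inner_right.1 y.2
  have hPP : ∀ y : (ℝ ∙ ν)ᗮ, P (y : Space 3) = y := fun y =>
    Submodule.orthogonalProjectionOnto_mem_subspace_eq_self y
  have hPnu : P ν = 0 :=
    Submodule.orthogonalProjectionOnto_orthogonal_apply_eq_zero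
      (Submodule.mem_span_singleton_self ν)
  have hinner : ∀ (y : (ℝ ∙ ν)ᗮ) (x : Space 3), ⟪(y : Space 3), (P x : Space 3)⟫ = ⟪(y : Space 3), x⟫ :=
    fun y x => by
    conv_rhs => rw [hdec x, inner_add_right, inner_smul_right, real_inner_comm ν, hPν, mul_zero,
      add_zero]
  have hPn : (P n : Space 3) = n := by
    have h1 := hdec n
    rw [real_inner_comm, hnν, zero_smul, add_zero] at h1
    exact h1.symm
  have hgt : ∀ᶠ t in 𝓝 (0 : ℝ), ⟪ν, a + t • e⟫ = γ (P (a + t • e)) := by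
    have hc : Tendsto (fun t : ℝ => a + t • e) (𝓝 0) (𝓝 a) :=
      Continuous.tendsto' (by fun_prop) _ _ (by simp)
    filter_upwards [haxis, hc.eventually hgraph] with t h1 h2 using h2.1 h1
  set e' : Space 3 := (P e : Space 3) with he'
  -- If `e` were parallel to `ν`, the graph would contain distinct points of the segment above one
  -- base point.
  have he'0 : e' ≠ 0 := by
    intro h0
    have hPe : P e = 0 := Subtype.ext h0
    have h1 : ∀ᶠ t in 𝓝[>] (0 : ℝ), ⟪ν, a + t • e⟫ = γ (P (a + t • e)) :=
      hgt.filter_mono nhdsWithin_le_nhds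
    obtain ⟨t, ht, ht0⟩ := (h1.and (self_mem_nhdsWithin : Ioi (0 : ℝ) ∈ 𝓝[>] 0)).exists
    have h2 := hgt.self_of_nhds
    rw [zero_smul, add_zero] at h2
    rw [map_add, map_smul, hPe, smul_zero, add_zero, ← h2, inner_add_right, inner_smul_right] at ht
    have h3 : ⟪ν, e⟫ = 0 := by
      have h4 : t * ⟪ν, e⟫ = 0 := by linarith
      exact (mul_eq_zero.1 h4).resolve_left (ne_of_gt ht0)
    have h5 := hdec e
    rw [← he', h0, h3, zero_smul, add_zero] at h5
    rw [h5, norm_zero] at he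
    exact zero_ne_one he
  have hee : 0 < ‖e'‖ ^ 2 := by have := norm_pos_iff.2 he'0; positivity
  have hen : ⟪e', n⟫ = 0 := by
    rw [real_inner_comm, ← hPn, he', hinner, hPn, hne]
  set y : ℝ × ℝ → (ℝ ∙ ν)ᗮ := fun p => P a + p.1 • P e + p.2 • P n with hy
  set X : ℝ × ℝ → Space 3 := fun p => (y p : Space 3) + γ (y p) • ν with hX
  -- `P e` and `n` are orthogonal to each other and to `ν`, so inner products with them recover the
  -- base coordinates and ignore the height. The left inverse is therefore globally Lipschitz.
  set Yl : Space 3 →L[ℝ] ℝ × ℝ := ((‖e'‖ ^ 2)⁻¹ • innerSL ℝ e').prod (innerSL ℝ n) with hYl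
  have hyc : ContDiff ℝ 1 y := by
    refine ContDiff.add (ContDiff.add contDiff_const ?_) ?_
    · exact contDiff_fst.smul contDiff_const
    · exact contDiff_snd.smul contDiff_const
  have hXc : ContDiff ℝ 1 X :=
    ((ℝ ∙ ν)ᗮ.subtypeL.contDiff.comp hyc).add
      (((hγ.of_le (by norm_num)).comp hyc).smul contDiff_const)
  have hXν : ∀ p, ⟪ν, X p⟫ = γ (y p) := fun p => by
    simp only [hX]
    rw [inner_add_right, hPν, inner_smul_right, real_inner_self_eq_norm_sq, hν]
    ring
  have hPX : ∀ p, P (X p) = y p := fun p => by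
    simp only [hX]
    rw [map_add, map_smul, hPnu, hPP, smul_zero, add_zero]
  have hX0 : X 0 = a := by
    have h2 := hgt.self_of_nhds
    rw [zero_smul, add_zero] at h2
    have h3 : y 0 = P a := by simp [hy]
    simp only [hX]
    rw [h3, ← h2]
    exact (hdec a).symm
  refine ⟨_, _, _, X, fun x => Yl (x - a), (IsSegmentChart.of_eventually hXc
    (KY := ‖Yl‖₊ * 1) ?_ ?_ ?_ ?_).choose_spec.choose_spec⟩
  · exact Yl.lipschitz.comp (LipschitzWith.of_dist_le_mul fun x z => by simp)
  · intro p
    have h1 : ∀ q : (ℝ ∙ ν)ᗮ, ⟪(q : Space 3), X p - a⟫ = p.1 * ⟪(q : Space 3), e'⟫ + p.2 * ⟪(q : Space 3), n⟫ := by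
      intro q
      simp only [hX, hy]
      rw [inner_sub_right, inner_add_right, inner_smul_right, real_inner_comm ν, hPν]
      push_cast
      rw [inner_add_right, inner_add_right, inner_smul_right, inner_smul_right, hinner q a, hPn]
      ring
    have h2 : ⟪e', X p - a⟫ = p.1 * ‖e'‖ ^ 2 := by
      rw [he', h1, ← he', hen, real_inner_self_eq_norm_sq]; ring
    have h3 : ⟪n, X p - a⟫ = p.2 := by
      have h4 := h1 (P n)
      rw [hPn, real_inner_self_eq_norm_sq, hn, real_inner_comm e', hen] at h4
      rw [h4]; ring
    refine Prod.ext ?_ ?_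
    · simp only [hYl, ContinuousLinearMap.prod_apply, smul_apply,
        innerSL_apply_apply, smul_eq_mul]
      rw [h2]
      field_simp
    · simp only [hYl, ContinuousLinearMap.prod_apply, innerSL_apply_apply]
      exact h3
  · have hc : Tendsto X (𝓝 0) (𝓝 a) := by
      have := hXc.continuous.tendsto 0
      rwa [hX0] at this
    filter_upwards [hc.eventually hgraph] with p hp
    rw [hp, hXν, hPX]
  · filter_upwards [hgt] with t ht
    have h1 : y (t, 0) = P (a + t • e) := by simp [hy]
    simp only [hX]
    rw [h1, ← ht]
    exact (hdec _).symm

/-! ### Surface measure in a chart -/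

/-- The normalisation factor between two-dimensional Euclidean and plain Hausdorff measure. -/
def areaFactor : ℝ≥0 :=
  Measure.addHaarScalarFactor (volume : Measure (EuclideanSpace ℝ (Fin 2))) μH[(2 : ℕ)]

lemma areaFactor_pos : 0 < areaFactor :=
  pos_iff_ne_zero.2 (Measure.addHaarScalarFactor_volume_hausdorffMeasure_ne_zero 2)

lemma surfaceMeasure_apply {Ω : Set (Space 3)} {A : Set (Space 3)} (hA : MeasurableSet A) :
    surfaceMeasure Ω A = areaFactor * μH[2] (A ∩ frontier Ω) := by
  rw [surfaceMeasure, Measure.restrict_apply hA, Measure.euclideanHausdorffMeasure_def,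
    Measure.smul_apply, ENNReal.smul_def, smul_eq_mul]
  simp [areaFactor]

namespace IsSegmentChart

variable {Ω : Set (Space 3)} {a e : Space 3} {ρ : ℝ} {KX KY : ℝ≥0} {X : ℝ × ℝ → Space 3}
  {Y : Space 3 → ℝ × ℝ}

/-- A set `E` is the image under the Lipschitz map `Y` of its own lift `X '' E`, so its area is at
most `KY²` times the Hausdorff measure of the lift. -/
lemma map_le (h : IsSegmentChart Ω a e ρ KX KY X Y) {E : Set (ℝ × ℝ)}
    (hEρ : E ⊆ Metric.ball 0 ρ) :
    Measure.map X (volume.restrict E) ≤ (KY ^ 2 / areaFactor) • surfaceMeasure Ω := by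
  refine Measure.le_iff.2 fun A hA => ?_
  have hXm : Measurable X := h.contDiff.continuous.measurable
  rw [Measure.map_apply hXm hA, Measure.restrict_apply (hXm hA), Measure.smul_apply,
    surfaceMeasure_apply hA, ENNReal.smul_def, smul_eq_mul, ← mul_assoc, ← ENNReal.coe_mul,
    div_mul_cancel₀ _ areaFactor_pos.ne', ← hausdorffMeasure_prod_real]
  have h1 : X ⁻¹' A ∩ E = Y '' (X '' (X ⁻¹' A ∩ E)) := by
    rw [image_image]
    simp [h.left_inv]
  have h2 := h.lipschitz_inv.hausdorffMeasure_image_le (d := 2) (by norm_num) (X '' (X ⁻¹' A ∩ E))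
  rw [h1]
  refine h2.trans ?_
  rw [ENNReal.rpow_ofNat, ENNReal.coe_pow]
  gcongr
  rintro _ ⟨p, hp, rfl⟩
  exact ⟨hp.1, h.mem p (hEρ hp.2)⟩

lemma surfaceMeasure_image_ne_top (h : IsSegmentChart Ω a e ρ KX KY X Y) {E : Set (ℝ × ℝ)}
    (hE : IsCompact E) (hEρ : E ⊆ Metric.ball 0 ρ) : surfaceMeasure Ω (X '' E) ≠ ⊤ := by
  rw [surfaceMeasure_apply (hE.image h.contDiff.continuous).measurableSet]
  refine ENNReal.mul_ne_top ENNReal.coe_ne_top ?_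
  have h1 := (h.lipschitz.mono hEρ).hausdorffMeasure_image_le (d := 2) (by norm_num)
  rw [hausdorffMeasure_prod_real] at h1
  refine ((measure_mono inter_subset_left).trans h1).trans_lt ?_ |>.ne
  exact ENNReal.mul_lt_top (by simp) hE.measure_lt_top

/-- This bounds the area of the source piece from below, which matters because the size of the
potential is proportional to the square root of that area. -/
lemma volume_le_surfaceMeasure_image (h : IsSegmentChart Ω a e ρ KX KY X Y) {E : Set (ℝ × ℝ)}
    (hE : IsCompact E) (hEρ : E ⊆ Metric.ball 0 ρ) :
    volume.real E ≤ (KY ^ 2 / areaFactor : ℝ≥0) * (surfaceMeasure Ω).real (X '' E) := by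
  have hm := (hE.image h.contDiff.continuous).measurableSet
  have h1 := h.map_le hEρ (X '' E)
  have hXm : Measurable X := h.contDiff.continuous.measurable
  rw [Measure.map_apply hXm hm, Measure.restrict_apply (hXm hm),
    inter_eq_self_of_subset_right (subset_preimage_image X E), Measure.smul_apply,
    ENNReal.smul_def, smul_eq_mul] at h1
  have h2 := ENNReal.toReal_mono
    (ENNReal.mul_ne_top ENNReal.coe_ne_top (h.surfaceMeasure_image_ne_top hE hEρ)) h1
  rwa [ENNReal.toReal_mul, ENNReal.coe_toReal] at h2

lemma mem_ball_strip {t w : ℝ} (ht : |t| < ρ) (hw : |w| < ρ) : (t, w) ∈ Metric.ball (0 : ℝ × ℝ) ρ := by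
  rw [mem_ball_zero_iff, Prod.norm_def]
  exact max_lt ht hw

/-- The image of a rectangle along the segment. -/
def rectImage (X : ℝ × ℝ → Space 3) (α β w : ℝ) : Set (Space 3) :=
  X '' (Icc α β ×ˢ Icc (-w) w)

lemma rect_subset_ball {α β w : ℝ} (hα : -ρ < α) (hβ : β < ρ) (hwρ : w < ρ) :
    Icc α β ×ˢ Icc (-w) w ⊆ Metric.ball (0 : ℝ × ℝ) ρ := by
  rintro ⟨t, s⟩ ⟨ht, hs⟩
  exact mem_ball_strip (abs_lt.2 ⟨by linarith [ht.1], by linarith [ht.2]⟩)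
    ((abs_le.2 ⟨hs.1, hs.2⟩).trans_lt hwρ)

lemma isBoundaryStrip (h : IsSegmentChart Ω a e ρ KX KY X Y) (he : ‖e‖ = 1) {α β w : ℝ}
    (hα : -ρ < α) (hαβ : α < β) (hβ : β < ρ) (hwρ : w < ρ) :
    IsBoundaryStrip Ω e α β (Icc (-w) w) volume (KY ^ 2 / areaFactor)
      (rectImage X α β w) X (fun x => fderiv ℝ X (Y x) (1, 0)) := by
  have hball := rect_subset_ball hα hβ hwρ
  have hXc := h.contDiff.continuous
  have hcf : Continuous fun p => fderiv ℝ X p (1, 0) :=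
    (h.contDiff.continuous_fderiv one_ne_zero).clm_apply continuous_const
  have hder : ∀ t s : ℝ, HasDerivAt (fun t => X (t, s)) (fderiv ℝ X (t, s) (1, 0)) t := fun t s => by
    have h1 : HasDerivAt (fun t : ℝ => ((t, s) : ℝ × ℝ)) (1, 0) t :=
      (hasDerivAt_id _).prodMk (hasDerivAt_const _ _)
    exact HasFDerivAt.comp_hasDerivAt (f := fun t : ℝ => ((t, s) : ℝ × ℝ)) t
      ((h.contDiff.differentiable one_ne_zero).differentiableAt.hasFDerivAt) h1
  refine ⟨hαβ, measurableSet_Icc, measure_Icc_lt_top.ne,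
    ((isCompact_Icc.prod isCompact_Icc).image hXc).measurableSet, hXc.measurable,
    (hcf.comp h.lipschitz_inv.continuous).measurable, ?_, fun t ht s hs => ⟨(t, s), ⟨ht, hs⟩, rfl⟩,
    fun t ht s hs => ?_, ?_, ?_, ?_⟩
  · rw [Measure.prod_restrict, ← Measure.volume_eq_prod]
    exact h.map_le hball
  · rw [h.left_inv]
    exact hder t s
  · rintro _ ⟨⟨t, s⟩, hp, rfl⟩
    rw [h.left_inv]
    refine mem_tangentSpan_of_hasDerivAt (c := fun t => X (t, s)) (t := t) (hder t s) ?_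
    have hc : Tendsto (fun t : ℝ => ((t, s) : ℝ × ℝ)) (𝓝 t) (𝓝 (t, s)) :=
      Continuous.tendsto (f := fun t : ℝ => ((t, s) : ℝ × ℝ)) (by fun_prop) t
    filter_upwards [hc.eventually (Metric.isOpen_ball.mem_nhds (hball hp))] with r hr
      using h.mem _ hr
  · rintro _ ⟨p, hp, rfl⟩
    rw [h.left_inv]
    have h1 := h.deriv_near p (hball hp)
    have h2 := norm_sub_norm_le (fderiv ℝ X p (1, 0)) e
    rw [he] at h2
    linarith
  · rintro _ ⟨p, hp, rfl⟩
    rw [h.left_inv]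
    have h1 := h.deriv_near p (hball hp)
    have h2 := abs_real_inner_le_norm e (fderiv ℝ X p (1, 0) - e)
    rw [inner_sub_right, real_inner_self_eq_norm_sq, he] at h2
    have h3 := (abs_le.1 h2).1
    linarith

/-- Differences between points of two thin rectangles are nearly parallel to the segment. -/
lemma exists_sub_eq (h : IsSegmentChart Ω a e ρ KX KY X Y) {α β α' β' w : ℝ}
    (hα : -ρ < α) (hβ : β < ρ) (hα' : -ρ < α') (hβ' : β' < ρ) (hw : 0 ≤ w) (hwρ : w < ρ)
    {x y : Space 3} (hx : x ∈ rectImage X α β w) (hy : y ∈ rectImage X α' β' w) :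
    ∃ (D : ℝ) (z : Space 3), D ∈ Icc (α - β') (β - α') ∧ ‖z‖ ≤ 2 * KX * w ∧ x - y = D • e + z := by
  have key : ∀ (t s : ℝ), |t| < ρ → s ∈ Icc (-w) w → ‖X (t, s) - (a + t • e)‖ ≤ KX * w := by
    intro t s ht hs
    have hsw : |s| ≤ w := abs_le.2 ⟨hs.1, hs.2⟩
    rw [← h.axis t ht, ← dist_eq_norm]
    refine (h.lipschitz.dist_le_mul _ (mem_ball_strip ht (hsw.trans_lt hwρ)) _
      (mem_ball_strip ht (by simpa using h.pos))).trans ?_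
    gcongr
    rw [Prod.dist_eq, dist_self, Real.dist_eq, sub_zero]
    exact max_le hw hsw
  obtain ⟨⟨t, s⟩, ⟨ht, hs⟩, rfl⟩ := hx
  obtain ⟨⟨t', s'⟩, ⟨ht', hs'⟩, rfl⟩ := hy
  have h1 := key t s (abs_lt.2 ⟨by linarith [ht.1], by linarith [ht.2]⟩) hs
  have h2 := key t' s' (abs_lt.2 ⟨by linarith [ht'.1], by linarith [ht'.2]⟩) hs'
  refine ⟨t - t', (X (t, s) - (a + t • e)) - (X (t', s') - (a + t' • e)),
    ⟨by linarith [ht.1, ht'.2], by linarith [ht.2, ht'.1]⟩, ?_, ?_⟩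
  · refine (norm_sub_le _ _).trans ?_
    linarith
  · rw [sub_smul]
    abel

end IsSegmentChart

/-! ### The three-dimensional fundamental solution on nearly parallel directions -/

/-- The paraxial estimate: with `q = x - y` and `s = ⟪e, q⟫`, one has `|q|² - s² ≤ h²` and `|q| + s
≥ 2r`, so the phase `k(|q| - s)` lies in `[0, 1]` and its cosine is at least `1/2`. Since `r ≤ |q| ≤
5r`, the kernel has size between `1/(20πr)` and `1/(4πr)`. -/
lemma spherical_wave_bounds {e z : Space 3} {D k h r : ℝ} (he : ‖e‖ = 1) (hr : 0 < r)
    (hD : D ∈ Icc (2 * r) (4 * r)) (hz : ‖z‖ ≤ h) (hh : h ≤ r) (hk : 0 ≤ k)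
    (hkh : k * h ^ 2 ≤ 2 * r) {x y : Space 3} (hxy : x - y = D • e + z) :
    1 / (40 * Real.pi * r) ≤ (fundamentalSolution 3 k x y * planeWave e k (x - y)).re ∧
    ‖fundamentalSolution 3 k x y * planeWave e k (x - y)‖ ≤ 1 / (4 * Real.pi * r) := by
  have hpi := Real.pi_pos
  set q := x - y
  set s := ⟪e, q⟫ with hs
  have hsz : s = D + ⟪e, z⟫ := by
    rw [hs, hxy, inner_add_right, inner_smul_right, real_inner_self_eq_norm_sq, he]; ring
  have hez : |⟪e, z⟫| ≤ h := (abs_real_inner_le_norm e z).trans (by rwa [he, one_mul])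
  obtain ⟨hez1, hez2⟩ := abs_le.1 hez
  have hsr : r ≤ s := by rw [hsz]; linarith [hD.1]
  have hsq : s ≤ ‖q‖ := by
    have := real_inner_le_norm e q
    rwa [he, one_mul] at this
  have hqr : r ≤ ‖q‖ := hsr.trans hsq
  have hq5 : ‖q‖ ≤ 5 * r := by
    rw [hxy]
    refine (norm_add_le _ _).trans ?_
    rw [norm_smul, he, mul_one, Real.norm_eq_abs, abs_of_nonneg (by linarith [hD.1])]
    linarith [hD.2]
  have hsq2 : ‖q‖ ^ 2 - s ^ 2 ≤ h ^ 2 := by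
    have h1 : ‖q‖ ^ 2 = D ^ 2 + 2 * (D * ⟪e, z⟫) + ‖z‖ ^ 2 := by
      rw [hxy, norm_add_sq_real, norm_smul, he, inner_smul_left, Real.norm_eq_abs, mul_one, sq_abs]
      simp
    have h2 : ‖z‖ ^ 2 ≤ h ^ 2 := by gcongr
    rw [h1, hsz]
    nlinarith [sq_nonneg ⟪e, z⟫]
  have hphase : k * (‖q‖ - s) ≤ 1 := by
    have h1 : (‖q‖ - s) * (2 * r) ≤ h ^ 2 := by nlinarith
    have h2 : k * (‖q‖ - s) * (2 * r) ≤ 1 * (2 * r) := by nlinarith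
    exact le_of_mul_le_mul_right h2 (by linarith)
  have hphase0 : 0 ≤ k * (‖q‖ - s) := mul_nonneg hk (by linarith)
  have heq : fundamentalSolution 3 k x y * planeWave e k q =
      Complex.exp ((k * (‖q‖ - s) : ℝ) * Complex.I) * ((4 * Real.pi * ‖q‖)⁻¹ : ℝ) := by
    rw [fundamentalSolution, if_neg (by norm_num), planeWave]
    have h1 : Complex.exp (Complex.I * k * ‖x - y‖) * Complex.exp (-(Complex.I * (k * ⟪e, q⟫ : ℝ)))
        = Complex.exp ((k * (‖q‖ - s) : ℝ) * Complex.I) := by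
      rw [← Complex.exp_add]
      congr 1
      push_cast
      ring
    rw [div_mul_eq_mul_div, h1]
    push_cast
    rfl
  have hq0 : 0 < ‖q‖ := hr.trans_le hqr
  rw [heq]
  constructor
  · rw [Complex.re_mul_ofReal, Complex.exp_ofReal_mul_I_re]
    have hcos : 1 / 2 ≤ Real.cos (k * (‖q‖ - s)) := by
      have := Real.one_sub_sq_div_two_le_cos (x := k * (‖q‖ - s))
      nlinarith
    calc 1 / (40 * Real.pi * r) = 1 / 2 * (4 * Real.pi * (5 * r))⁻¹ := by field_simp; norm_num
      _ ≤ _ := by gcongr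
  · rw [norm_mul, Complex.norm_exp_ofReal_mul_I, one_mul, Complex.norm_real, Real.norm_eq_abs,
      abs_of_pos (by positivity), one_div]
    gcongr

open IsSegmentChart

lemma measurable_fundamentalSolution_three (k : ℝ) (x : Space 3) :
    Measurable fun y => fundamentalSolution 3 k x y := by
  simp only [fundamentalSolution, if_neg (show ¬(3 = 2) by norm_num)]
  refine Measurable.div ?_ ?_
  · exact Continuous.measurable (by fun_prop)
  · exact Continuous.measurable (by fun_prop)

/-- The potential of a plane wave packet on a thin rectangle, evaluated on another one. -/
lemma singleLayer_rectImage_bounds {Ω : Set (Space 3)} {a e : Space 3} {ρ : ℝ} {KX KY : ℝ≥0}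
    {X : ℝ × ℝ → Space 3} {Y : Space 3 → ℝ × ℝ} (h : IsSegmentChart Ω a e ρ KX KY X Y)
    (he : ‖e‖ = 1) {k r w : ℝ} (hk : 0 ≤ k) (hr : 0 < r) (hrρ : 2 * r < ρ) (hw : 0 ≤ w)
    (hwr : w * (2 * KX + 1) ≤ r) (hkw : k * (2 * KX * w) ^ 2 ≤ 2 * r) {x : Space 3}
    (hx : x ∈ rectImage X r (2 * r) w) :
    √((surfaceMeasure Ω).real (rectImage X (-(2 * r)) (-r) w)) * (1 / (40 * Real.pi * r)) ≤
      (singleLayer Ω k (planeWavePacket Ω e k (rectImage X (-(2 * r)) (-r) w)) x *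
        planeWave e k x).re ∧
    ‖singleLayer Ω k (planeWavePacket Ω e k (rectImage X (-(2 * r)) (-r) w)) x *
        planeWave e k x‖ ≤
      √((surfaceMeasure Ω).real (rectImage X (-(2 * r)) (-r) w)) * (1 / (4 * Real.pi * r)) := by
  have hKX : (0 : ℝ) ≤ KX := KX.2
  have hwr' : w ≤ r := by nlinarith
  have hwρ : w < ρ := by linarith
  set S₁ := rectImage X (-(2 * r)) (-r) w with hS₁
  have hm : MeasurableSet S₁ :=
    ((isCompact_Icc.prod isCompact_Icc).image h.contDiff.continuous).measurableSet
  have hfin : surfaceMeasure Ω S₁ ≠ ⊤ := h.surfaceMeasure_image_ne_top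
    (isCompact_Icc.prod isCompact_Icc) (rect_subset_ball (by linarith) (by linarith) hwρ)
  have hpt : ∀ y ∈ S₁,
      1 / (40 * Real.pi * r) ≤ (fundamentalSolution 3 k x y * planeWave e k (x - y)).re ∧
      ‖fundamentalSolution 3 k x y * planeWave e k (x - y)‖ ≤ 1 / (4 * Real.pi * r) := by
    intro y hy
    obtain ⟨D, z, hD, hz, hxy⟩ := h.exists_sub_eq (by linarith) (by linarith) (by linarith)
      (by linarith) hw hwρ hx hy
    exact spherical_wave_bounds he hr ⟨by linarith [hD.1], by linarith [hD.2]⟩ hz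
      (by nlinarith) hk hkw hxy
  have hfm : IsFiniteMeasure ((surfaceMeasure Ω).restrict S₁) := ⟨by simpa using hfin.lt_top⟩
  have hint : Integrable (fun y => fundamentalSolution 3 k x y * planeWave e k (x - y))
      ((surfaceMeasure Ω).restrict S₁) := by
    refine Integrable.of_bound (Measurable.aestronglyMeasurable ?_) (1 / (4 * Real.pi * r)) ?_
    · exact (measurable_fundamentalSolution_three k x).mul
        ((continuous_planeWave e k).comp (by fun_prop : Continuous fun y => x - y)).measurable
    · exact (ae_restrict_mem hm).mono fun y hy => (hpt y hy).2
  rw [singleLayer_planeWavePacket_mul hm]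
  set s := (surfaceMeasure Ω).real S₁ with hs
  have hs0 : 0 ≤ s := measureReal_nonneg
  -- Integration over the source gives its area `s`, and normalisation divides by `√s`; the identity
  -- holds for `s = 0` as well.
  have hss : (√s)⁻¹ * s = √s := by
    rcases hs0.eq_or_lt with h0 | h0
    · rw [← h0]; simp
    · have h1 : √s ≠ 0 := (Real.sqrt_pos.2 h0).ne'
      field_simp
      rw [Real.sq_sqrt hs0]
  constructor
  · rw [Complex.re_ofReal_mul]
    have h1 : s * (1 / (40 * Real.pi * r)) ≤
        (∫ y in S₁, fundamentalSolution 3 k x y * planeWave e k (x - y) ∂surfaceMeasure Ω).re := by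
      have h2 : ∫ y in S₁, (fundamentalSolution 3 k x y * planeWave e k (x - y)).re
          ∂surfaceMeasure Ω = (∫ y in S₁, fundamentalSolution 3 k x y * planeWave e k (x - y)
          ∂surfaceMeasure Ω).re := integral_re hint
      have h3 : ∫ _ in S₁, (1 / (40 * Real.pi * r)) ∂surfaceMeasure Ω =
          s * (1 / (40 * Real.pi * r)) := by
        rw [setIntegral_const, smul_eq_mul]
      rw [← h2, ← h3]
      exact integral_mono_ae (integrable_const _) hint.re
        ((ae_restrict_mem hm).mono fun y hy => (hpt y hy).1)
    calc √s * (1 / (40 * Real.pi * r)) = (√s)⁻¹ * (s * (1 / (40 * Real.pi * r))) := by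
          rw [← mul_assoc, hss]
      _ ≤ _ := by gcongr
  · rw [norm_mul, Complex.norm_real, Real.norm_eq_abs, abs_of_nonneg (by positivity)]
    have h1 := norm_setIntegral_le_of_norm_le_const (μ := surfaceMeasure Ω) hfin.lt_top
      (fun y hy => (hpt y hy).2)
    calc _ ≤ (√s)⁻¹ * (1 / (4 * Real.pi * r) * s) := by gcongr
      _ = (√s)⁻¹ * s * (1 / (4 * Real.pi * r)) := by ring
      _ = _ := by rw [hss]

/-- The case of three-dimensional space. -/
theorem exists_opNorm_bounds_three {Ω : Set (Space 3)} {a e : Space 3} {δ : ℝ} (he : ‖e‖ = 1)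
    (hδ : 0 < δ) (hseg : lineSegment a e δ ⊆ frontier Ω)
    (hC2 : IsC2BoundaryNear Ω (lineSegment a e δ)) :
    ∃ k₀ C : ℝ, 0 < k₀ ∧ 0 < C ∧ ∀ k : ℝ, k₀ ≤ k →
      ENNReal.ofReal (C * k ^ (-(1 / 2) : ℝ)) ≤ opNorm Ω (normL2 Ω) (singleLayer Ω k) ∧
      ENNReal.ofReal (C * k ^ (1 / 2 : ℝ)) ≤ opNorm Ω (normH1 Ω) (singleLayer Ω k) := by
  have ha : a ∈ lineSegment a e δ := ⟨0, by simpa using hδ, by simp⟩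
  obtain ⟨V, -, hVs, hV⟩ := hC2
  have haxis : ∀ᶠ t in 𝓝 (0 : ℝ), a + t • e ∈ frontier Ω := by
    filter_upwards [Metric.ball_mem_nhds (0 : ℝ) hδ] with t ht
    exact hseg ⟨t, by simpa using ht, rfl⟩
  obtain ⟨ρ, KX, KY, X, Y, h⟩ := exists_isSegmentChart he haxis (hV a ⟨hVs ha, hseg ha⟩)
  have hρ := h.pos
  set r : ℝ := ρ / 3 with hr
  have hr0 : 0 < r := by positivity
  -- Otherwise `Y` would be constant, although it inverts `X`.
  have hKY : 0 < KY := by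
    refine pos_iff_ne_zero.2 fun h0 => ?_
    have h1 := h.lipschitz_inv.dist_le_mul (X (1, 0)) (X 0)
    rw [h.left_inv, h.left_inv, h0, NNReal.coe_zero, zero_mul, dist_zero_right] at h1
    have h2 := norm_le_zero_iff.1 h1
    simp at h2
  set K : ℝ≥0 := KY ^ 2 / areaFactor with hK
  have hK0 : 0 < K := div_pos (by positivity) areaFactor_pos
  have hKr : (0 : ℝ) < K := by exact_mod_cast hK0
  have hKX : (0 : ℝ) ≤ KX := KX.2
  have hpi := Real.pi_pos
  -- With half-width `ε / √k` the quantity `k (2 KX w)²` equals `4 (KX ε)²`, independent of `k`;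
  -- this `ε` makes it at most `2r`, as the phase estimate requires.
  set ε : ℝ := √(r / 2) / (KX + 1) with hε
  have hε0 : 0 < ε := div_pos (Real.sqrt_pos.2 (by positivity)) (by positivity)
  have hεKX : 2 * (KX * ε) ^ 2 ≤ r := by
    have h1 : KX * ε ≤ √(r / 2) := by
      rw [hε, mul_div_assoc', div_le_iff₀ (by positivity)]
      nlinarith [Real.sqrt_nonneg (r / 2)]
    have h2 : (KX * ε) ^ 2 ≤ √(r / 2) ^ 2 := by gcongr
    rw [Real.sq_sqrt (by positivity)] at h2
    linarith
  set m : ℝ := 1 / (40 * Real.pi * r) with hm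
  have hm0 : 0 < m := by positivity
  -- The threshold `240 / r` is `24` times the ratio `b/a = 10`, divided by the strip length `r`;
  -- the last one makes the rectangles thin compared with `r`.
  set k₀ : ℝ := max 1 (max (240 / r) ((ε * (2 * KX + 1) / r) ^ 2)) with hk₀
  refine ⟨k₀, m * (2 * r * ε) / K / 48, by positivity, by positivity, fun k hk => ?_⟩
  have hk0 : 0 < k := one_pos.trans_le ((le_max_left _ _).trans hk)
  have hk1 : 240 / r ≤ k := ((le_max_left _ _).trans (le_max_right _ _)).trans hk
  have hk2 : (ε * (2 * KX + 1) / r) ^ 2 ≤ k :=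
    ((le_max_right _ _).trans (le_max_right _ _)).trans hk
  have hsk : 0 < √k := Real.sqrt_pos.2 hk0
  set w : ℝ := ε / √k with hw
  have hw0 : 0 < w := by positivity
  have hwr : w * (2 * KX + 1) ≤ r := by
    have h1 : ε * (2 * KX + 1) / r ≤ √k := Real.le_sqrt_of_sq_le hk2
    rw [div_le_iff₀ hr0] at h1
    rw [hw, div_mul_eq_mul_div, div_le_iff₀ hsk]
    linarith
  have hwr' : w ≤ r := by nlinarith
  have hkw : k * (2 * KX * w) ^ 2 ≤ 2 * r := by
    have h1 : k * (2 * KX * w) ^ 2 = 2 * (2 * (KX * ε) ^ 2) := by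
      have h2 : √k ^ 2 = k := Real.sq_sqrt hk0.le
      rw [hw]
      field_simp
      rw [h2]
      ring
    rw [h1]
    linarith
  have hstrip := h.isBoundaryStrip he (α := r) (β := 2 * r) (w := w) (by linarith) (by linarith)
    (by linarith) (by linarith)
  have hball := rect_subset_ball (ρ := ρ) (α := -(2 * r)) (β := -r) (w := w) (by linarith)
    (by linarith) (by linarith)
  have hcomp : IsCompact (Icc (-(2 * r)) (-r) ×ˢ Icc (-w) w) := isCompact_Icc.prod isCompact_Icc
  have hvol := h.volume_le_surfaceMeasure_image hcomp hball
  have hW : volume.real (Icc (-w) w) = 2 * w := by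
    rw [Real.volume_real_Icc_of_le (by linarith)]; ring
  rw [Measure.volume_eq_prod, measureReal_prod_prod, hW,
    Real.volume_real_Icc_of_le (by linarith)] at hvol
  set s := (surfaceMeasure Ω).real (rectImage X (-(2 * r)) (-r) w) with hs
  have hvol' : r * (2 * w) ≤ K * s := by
    refine le_trans (le_of_eq ?_) hvol
    ring
  refine le_opNorm_of_strip hstrip he hK0 (by rw [hW]; positivity)
    (hcomp.image h.contDiff.continuous).measurableSet
    (h.surfaceMeasure_image_ne_top hcomp hball) (κ := k) (a := √s * m) (b := √s * (10 * m)) (ζ := 1)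
    (abs_of_pos hk0) hk0 (by simp) (by positivity) (fun x hx => ?_) (fun x hx => ?_) ?_
    (by positivity) ?_
  · rw [one_mul]
    exact (singleLayer_rectImage_bounds h he hk0.le hr0 (by linarith) hw0.le hwr hkw hx).1
  · refine (singleLayer_rectImage_bounds h he hk0.le hr0 (by linarith) hw0.le hwr hkw hx).2.trans_eq ?_
    rw [hm]
    congr 1
    field_simp
    norm_num
  · rw [div_le_iff₀ hr0] at hk1
    have h1 : √s * m * (2 * r - r) * k = √s * m * (k * r) := by ring
    have h2 : 24 * (√s * (10 * m)) = √s * m * 240 := by ring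
    rw [h1, h2]
    gcongr
  -- Source and target rectangles have the same parameter area `2rw`. Bounding `√s` below by `√(2rw)
  -- / √K` turns the product of the two square roots into `2rw / K`, which is of order `k^{-1/2}`.
  · have hsK : 0 < √(K : ℝ) := Real.sqrt_pos.2 hKr
    have h1 : √(r * (2 * w)) ≤ √K * √s := by
      rw [← Real.sqrt_mul hKr.le]
      exact Real.sqrt_le_sqrt hvol'
    have h2 : √(r * (2 * w)) * √(r * (2 * w)) = r * (2 * w) :=
      Real.mul_self_sqrt (by positivity)
    have h3 : √(K : ℝ) * √K = K := Real.mul_self_sqrt hKr.le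
    have e1 : 2 * r - r = r := by ring
    rw [hW, e1, ← hK]
    calc 48 * (m * (2 * r * ε) / K / 48) / √k = m * (r * (2 * w)) / (√K * √K) := by
          rw [h3, hw]; field_simp
      _ = m * (√(r * (2 * w)) * √(r * (2 * w))) / (√K * √K) := by rw [h2]
      _ ≤ m * (√K * √s * √(r * (2 * w))) / (√K * √K) := by gcongr
      _ = _ := by field_simp

end Helmholtz

end
theorem lemma3p1 (d : ℕ) (hd : d = 2 ∨ d = 3) (Ω : Set (Helmholtz.Space d))
    (hΩ : Helmholtz.IsLipschitzObstacle Ω)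
    (a e : Helmholtz.Space d) (δ : ℝ) (he : ‖e‖ = 1) (hδ : 0 < δ)
    (hseg : Helmholtz.lineSegment a e δ ⊆ frontier Ω)
    (hC2 : Helmholtz.IsC2BoundaryNear Ω (Helmholtz.lineSegment a e δ)) :
    ∃ k₀ C : ℝ, 0 < k₀ ∧ 0 < C ∧ ∀ k : ℝ, k₀ ≤ k →
      ENNReal.ofReal (C * k ^ (-(1 / 2) : ℝ))
          ≤ Helmholtz.opNorm Ω (Helmholtz.normL2 Ω) (Helmholtz.singleLayer Ω k) ∧
      ENNReal.ofReal (C * k ^ (1 / 2 : ℝ))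
          ≤ Helmholtz.opNorm Ω (Helmholtz.normH1 Ω) (Helmholtz.singleLayer Ω k) := by
  rcases hd with rfl | rfl
  · exact Helmholtz.exists_opNorm_bounds_two he hδ hseg
  · exact Helmholtz.exists_opNorm_bounds_three he hδ hseg hC2
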